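/- Let $D$ be a reduced alternating diagram (on the sphere) of a prime link. Let $Col(D)$ be the abelian group generated by the arcs of $D$ with one relation $2b-a-c=0$ for each crossing, where $b$ is the over-arc and $a,c$ are the under-arcs at the crossing, and let $Col^{red}(D)$ be the quotient of $Col(D)$ by the infinite cyclic subgroup generated by one (arbitrary) base arc; up to isomorphism it does not depend on that arc. Suppose that $$Col^{red}(D)\cong \mathbb Z_{n_1}\oplus\mathbb Z_{n_2}\oplus\cdots\oplus\mathbb Z_{n_s},\qquad s\ge 1,\quad n_{i+1}\mid n_i \ \text{ for } 1\le i<s .$$ Then there are $s$ Fox $n_1$-colorings $y_1,\dots,y_s$ of $D$, i.e. functions $y_k:\mathrm{arcs}(D)\to\mathbb Z_{n_1}$ satisfying $2y_k(b)-y_k(a)-y_k(c)=0$ at each crossing, such that for every pair of distinct arcs $x\ne x'$ of $D$ there is a $k$ with $y_k(x)\neq y_k(x')$. Here a diagram is reduced if it has no nugatory crossing, and a link is prime if it is not the unknot, is not split, and in each decomposition of it as a connected sum one of the summands is the unknot. -/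

import Mathlib

/-!
# Link diagrams, Reidemeister equivalence, prime links and Fox colorings

Link diagrams on the sphere are encoded as 4-regular combinatorial maps with crossing
information.  A link type is a Reidemeister equivalence class of such diagrams.
-/

/-- A link diagram on a closed oriented surface, as a combinatorial map.

Around each crossing `x` the four half-edges ("darts") are `(x,0), (x,1), (x,2), (x,3)` in
counterclockwise order; the strand through `(x,0)` and `(x,2)` is the lower one, the strand
through `(x,1)` and `(x,3)` is the upper one.  The fixed-point free involution `opp` joins the
darts in pairs, which are the edges between crossings.  Components of the diagram which are
closed curves without any crossing carry no darts; there are `circles` many of them. -/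
structure PreDiagram where
  Crossing : Type
  finite : Finite Crossing
  opp : Crossing × ZMod 4 → Crossing × ZMod 4
  opp_opp : ∀ d, opp (opp d) = d
  opp_ne : ∀ d, opp d ≠ d
  circles : ℕ

namespace PreDiagram

/-- The half-edges of the diagram. -/
abbrev Dart (D : PreDiagram) : Type := D.Crossing × ZMod 4

/-- Walk along the dart `d` to the next crossing, keeping a face on the left, and turn left:
the next dart of the boundary of that face. -/
def faceNext (D : PreDiagram) (d : D.Dart) : D.Dart :=
  ((D.opp d).1, (D.opp d).2 - 1)

/-- The faces (regions) of the map: orbits of `faceNext`. The dart `(x, i)` stands for the corner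
at `x` between `(x, i)` and `(x, i + 1)`, and its class is the face containing this corner. -/
def Face (D : PreDiagram) : Type := Quot fun d e : D.Dart => e = D.faceNext d

/-- The face containing the corner between `(x, i)` and `(x, i + 1)`, for `d = (x, i)`. -/
def face (D : PreDiagram) (d : D.Dart) : D.Face := Quot.mk _ d

/-- The connected components of the underlying 4-regular graph. -/
def Component (D : PreDiagram) : Type :=
  Quot fun x y : D.Crossing => ∃ i : ZMod 4, (D.opp (x, i)).1 = y

/-- All connected components of the map have genus zero: `V - E + F = 2 C` with `E = 2 V`. -/
def Planar (D : PreDiagram) : Prop :=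
  Nat.card D.Face = Nat.card D.Crossing + 2 * Nat.card D.Component

/-- The underlying subset of the surface is connected (and nonempty). -/
def Connected (D : PreDiagram) : Prop := Nat.card D.Component + D.circles = 1

/-- The dart lies on the upper strand of its crossing. -/
def IsOver {D : PreDiagram} (d : D.Dart) : Prop := d.2 = 1 ∨ d.2 = 3

/-- Travelling along any edge, one passes over at one end and under at the other end. -/
def Alternating (D : PreDiagram) : Prop :=
  ∀ d : D.Dart, IsOver (D := D) (D.opp d) ↔ ¬ IsOver d

/-- A crossing is nugatory if two opposite corners at it belong to the same face, that is, if some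
circle on the sphere meets the diagram only in this crossing, where it separates two corners. -/
def Nugatory (D : PreDiagram) (x : D.Crossing) : Prop :=
  D.face (x, 0) = D.face (x, 2) ∨ D.face (x, 1) = D.face (x, 3)

/-- A diagram is reduced if it has no nugatory crossing. -/
def Reduced (D : PreDiagram) : Prop := ∀ x, ¬ D.Nugatory x

/-! ### Arcs and Fox colorings -/

/-- The two steps that can be made inside an arc of the diagram: along an edge, and through a
crossing on its upper strand. -/
inductive ArcStep (D : PreDiagram) : D.Dart → D.Dart → Prop
  | edge (d : D.Dart) : ArcStep D d (D.opp d)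
  | over (x : D.Crossing) : ArcStep D (x, 1) (x, 3)

/-- The arcs of a diagram: the maximal pieces which do not pass under a crossing, including the
closed curves without crossings. -/
def Arc (D : PreDiagram) : Type := Quot D.ArcStep ⊕ Fin D.circles

/-- The arc containing a given dart. -/
def arc (D : PreDiagram) (d : D.Dart) : D.Arc := Sum.inl (Quot.mk _ d)

/-- A Fox `k`-coloring: at each crossing with upper arc `b` and lower arcs `a`, `c` the colors
satisfy `2b - a - c = 0`. -/
def IsFoxColoring (D : PreDiagram) (k : ℕ) (f : D.Arc → ZMod k) : Prop :=
  ∀ x : D.Crossing, 2 * f (D.arc (x, 1)) - f (D.arc (x, 0)) - f (D.arc (x, 2)) = 0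

/-- The subgroup of relations `2b - a - c`, one for each crossing. -/
def colRelations (D : PreDiagram) : AddSubgroup (FreeAbelianGroup D.Arc) :=
  AddSubgroup.closure (Set.range fun x : D.Crossing =>
    2 • FreeAbelianGroup.of (D.arc (x, 1)) - FreeAbelianGroup.of (D.arc (x, 0))
      - FreeAbelianGroup.of (D.arc (x, 2)))

/-- The universal group of Fox colorings `Col(D)`. -/
abbrev Col (D : PreDiagram) : Type := FreeAbelianGroup D.Arc ⧸ D.colRelations

/-- The class of an arc in `Col(D)`. -/
def colArc (D : PreDiagram) (a : D.Arc) : D.Col :=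
  QuotientAddGroup.mk (FreeAbelianGroup.of a)

/-- The reduced group of Fox colorings: the quotient of `Col(D)` by the infinite cyclic subgroup
generated by a base arc. Up to isomorphism it does not depend on the base arc: the
homomorphism `Col(D) → ℤ` sending all arcs to `1` is split by each base arc. -/
abbrev ColRed (D : PreDiagram) (base : D.Arc) : Type :=
  D.Col ⧸ AddSubgroup.zmultiples (D.colArc base)

/-! ### Constructions of diagrams -/

/-- Isomorphism of diagrams: a bijection of the crossings which, up to a half turn at each
crossing, respects the darts. -/
def Iso (D E : PreDiagram) : Prop :=
  D.circles = E.circles ∧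
    ∃ (e : D.Crossing ≃ E.Crossing) (r : D.Crossing → ZMod 4),
      (∀ x, r x = 0 ∨ r x = 2) ∧
      ∀ d : D.Dart, E.opp (e d.1, d.2 + r d.1) =
        (e (D.opp d).1, (D.opp d).2 + r (D.opp d).1)

/-- Disjoint union of two diagrams. -/
def union (D E : PreDiagram) : PreDiagram where
  Crossing := D.Crossing ⊕ E.Crossing
  finite := by
    have := D.finite
    have := E.finite
    infer_instance
  opp d := match d with
    | (Sum.inl x, i) => (Sum.inl (D.opp (x, i)).1, (D.opp (x, i)).2)
    | (Sum.inr x, i) => (Sum.inr (E.opp (x, i)).1, (E.opp (x, i)).2)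
  opp_opp := by
    rintro ⟨x | x, i⟩
    · simp [D.opp_opp]
    · simp [E.opp_opp]
  opp_ne := by
    rintro ⟨x | x, i⟩ h
    · simp only [Prod.mk.injEq, Sum.inl.injEq] at h
      exact D.opp_ne (x, i) (Prod.ext h.1 h.2)
    · simp only [Prod.mk.injEq, Sum.inr.injEq] at h
      exact E.opp_ne (x, i) (Prod.ext h.1 h.2)
  circles := D.circles + E.circles

/-- A dart of the first diagram, in the disjoint union. -/
def inl {D : PreDiagram} (E : PreDiagram) (d : D.Dart) : (D.union E).Dart := (Sum.inl d.1, d.2)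

/-- A dart of the second diagram, in the disjoint union. -/
def inr (D : PreDiagram) {E : PreDiagram} (d : E.Dart) : (D.union E).Dart := (Sum.inr d.1, d.2)

/-- Keep the crossings, and transport the edges along a permutation of the darts: if an edge
joined `d` and `e`, an edge of the new diagram joins `τ d` and `τ e`. -/
def conj (D : PreDiagram) (τ : Equiv.Perm D.Dart) : PreDiagram where
  Crossing := D.Crossing
  finite := D.finite
  opp d := τ (D.opp (τ.symm d))
  opp_opp d := by simp [D.opp_opp]
  opp_ne d h := D.opp_ne (τ.symm d) (by rw [Equiv.eq_symm_apply]; exact h)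
  circles := D.circles

open Classical in
/-- Cut the edge at `p` and the edge at `q`, which are supposed to be different, and rejoin the
four ends: `p` with `q`, and the other end of the edge at `p` with the other end of the edge
at `q`. -/
noncomputable def reconnect (D : PreDiagram) (p q : D.Dart) : PreDiagram :=
  D.conj (Equiv.swap (D.opp p) q)

/-- Connected sum along the edge at `a` and the edge at `b`: the dart `a` is joined with `b`, and
`D.opp a` with `E.opp b`. -/
noncomputable def connectedSum (D E : PreDiagram) (a : D.Dart) (b : E.Dart) : PreDiagram :=
  (D.union E).reconnect (inl E a) (inr D b)

/-- The crossingless diagram of the unknot. -/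
def circle : PreDiagram where
  Crossing := Empty
  finite := inferInstance
  opp := id
  opp_opp _ := rfl
  opp_ne d := d.1.elim
  circles := 1

/-- The diagrams of the unknot with one crossing: `i` is joined with `i + 1` and `i + 2` with
`i + 3`. -/
def curl (i : ZMod 4) : PreDiagram where
  Crossing := Unit
  finite := inferInstance
  opp d := ((), 2 * i + 1 - d.2)
  opp_opp d := by simp
  opp_ne := by revert i; decide
  circles := 0

/-- A round circle lying over another one and meeting it in two crossings `false` and `true`, whose
darts `1` point right and whose darts `2` point up. The edges are `(false,1)`-`(true,3)` and
`(false,3)`-`(true,1)` in the upper circle and `(false,2)`-`(true,2)` and `(false,0)`-`(true,0)`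
in the lower one. The edges `(false,1)`-`(true,3)` and `(false,2)`-`(true,2)` bound a bigon. -/
def overlappingCircles : PreDiagram where
  Crossing := Bool
  finite := inferInstance
  opp d := (!d.1, - d.2)
  opp_opp d := by simp
  opp_ne := by decide
  circles := 0

/-! ### Reidemeister moves

A move relates two diagrams; it is used below only between diagrams on the sphere. -/

/-- First Reidemeister move on an edge: insert a curl (of any of the kinds) in the edge. -/
def R1 (D E : PreDiagram) : Prop :=
  ∃ (i : ZMod 4) (a : D.Dart) (b : (curl i).Dart), Iso (D.connectedSum (curl i) a b) E

/-- First Reidemeister move on a component without crossings. -/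
def R1Circle (D E : PreDiagram) : Prop :=
  ∃ (F : PreDiagram) (i : ZMod 4), Iso (F.union circle) D ∧ Iso (F.union (curl i)) E

/-- Second Reidemeister move: the edge at `a` is pushed over the edge at `b`, creating a bigon with
two new crossings `x = false` and `y = true`. The strand `a — opp a` now runs
`a — (x,3) (x,1) — (y,3) (y,1) — opp a`, and `b — opp b` now runs
`b — (x,0) (x,2) — (y,2) (y,0) — opp b`. If both edges are in the same component of a planar
map, the result is planar only if the two edges are adjacent to a common face, on the right of
`a` and on the left of `b`. -/
def R2 (D E : PreDiagram) : Prop :=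
  ∃ a b : D.Dart, b ≠ a ∧ b ≠ D.opp a ∧
    Iso (((D.union overlappingCircles).reconnect
        (inl overlappingCircles a) (inr (E := overlappingCircles) D (false, 3))).reconnect
        (inl overlappingCircles b) (inr (E := overlappingCircles) D (false, 0))) E

/-- The dart on the other side of the crossing, on the same strand. -/
def across {D : PreDiagram} (d : D.Dart) : D.Dart := (d.1, d.2 + 2)

open Classical in
/-- For an edge joining `d` and `e = opp d`, the strand through it runs
`(across d) d — e (across e)`. Exchanging `across d` with `e` and `d` with `across e` makes this
strand pass the two crossings in the opposite order. -/
noncomputable def strandSwap (D : PreDiagram) (d : D.Dart) : Equiv.Perm D.Dart :=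
  Equiv.swap (across d) (D.opp d) * Equiv.swap d (across (D := D) (D.opp d))

/-- Third Reidemeister move: `d₁, d₂, d₃` are the boundary darts of a triangular face with
three different crossings, one of the three strands is the upper one at both of its
crossings, and each of the three strands is moved across the crossing of the two others. -/
def R3 (D E : PreDiagram) : Prop :=
  ∃ d₁ d₂ d₃ : D.Dart,
    D.faceNext d₁ = d₂ ∧ D.faceNext d₂ = d₃ ∧ D.faceNext d₃ = d₁ ∧
    d₁.1 ≠ d₂.1 ∧ d₂.1 ≠ d₃.1 ∧ d₃.1 ≠ d₁.1 ∧
    IsOver d₁ ∧ IsOver (D := D) (D.opp d₁) ∧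
    Iso (D.conj (D.strandSwap d₁ * D.strandSwap d₂ * D.strandSwap d₃)) E

end PreDiagram

/-- A link diagram on the sphere, up to the position of its connected components relative to each
other, which does not affect the link. -/
structure LinkDiagram extends PreDiagram where
  planar : toPreDiagram.Planar

namespace LinkDiagram

/-- One Reidemeister move or isomorphism between diagrams on the sphere. The moves between two
segments of the same edge, or involving components without crossings, which are not listed,
are compositions of those listed. -/
def Move (D E : LinkDiagram) : Prop :=
  D.Iso E.toPreDiagram ∨ D.R1 E.toPreDiagram ∨ D.R1Circle E.toPreDiagram ∨
    D.R2 E.toPreDiagram ∨ D.R3 E.toPreDiagram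

/-- Two diagrams represent the same (unoriented) link type: they are connected by a finite sequence
of Reidemeister moves and their inverses. -/
def SameLink : LinkDiagram → LinkDiagram → Prop := Relation.EqvGen Move

/-- The crossingless diagram of the unknot. -/
def unknot : LinkDiagram where
  toPreDiagram := PreDiagram.circle
  planar := by
    have h1 : IsEmpty PreDiagram.circle.Face := by
      refine ⟨fun f => ?_⟩
      induction f using Quot.ind with
      | mk d => exact d.1.elim
    have h2 : IsEmpty PreDiagram.circle.Component := by
      refine ⟨fun f => ?_⟩
      induction f using Quot.ind with
      | mk x => exact x.elim
    have h3 : IsEmpty PreDiagram.circle.Crossing := inferInstanceAs (IsEmpty Empty)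
    simp [PreDiagram.Planar]

/-- The link represented by `D` is the unknot. -/
def IsUnknot (D : LinkDiagram) : Prop := D.SameLink unknot

/-- The link represented by `D` is split: it has a disconnected diagram. (The empty link counts as
split.) -/
def IsSplit (D : LinkDiagram) : Prop := ∃ E : LinkDiagram, D.SameLink E ∧ ¬ E.Connected

/-- The link represented by `D` is a connected sum of the links represented by `D₁` and `D₂`:
some diagrams of the latter two have a diagrammatic connected sum which represents the
former. -/
def IsConnectedSum (D D₁ D₂ : LinkDiagram) : Prop :=
  ∃ E E₁ E₂ : LinkDiagram, D.SameLink E ∧ D₁.SameLink E₁ ∧ D₂.SameLink E₂ ∧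
    ∃ (a : E₁.Dart) (b : E₂.Dart),
      (E₁.connectedSum E₂.toPreDiagram a b).Iso E.toPreDiagram

/-- The link represented by `D` is prime: it is not the unknot, it is not split, and in each
decomposition as a connected sum one of the summands is the unknot. -/
def RepresentsPrimeLink (D : LinkDiagram) : Prop :=
  ¬ D.IsUnknot ∧ ¬ D.IsSplit ∧
    ∀ D₁ D₂ : LinkDiagram, D.IsConnectedSum D₁ D₂ → D₁.IsUnknot ∨ D₂.IsUnknot

end LinkDiagram

namespace PreDiagram

/-! The core is that distinct arcs have distinct classes in `Col(D)` (`colArc_injective`). In an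
alternating diagram without crossingless circles each arc passes over exactly one crossing, so arcs
correspond to crossings. Direct every edge from its upper to its lower end; then each crossing has
two outgoing and two incoming edges, and the relation matrix is a discrete Laplacian. If the arcs
over `x` and `y` agree in `Col(D)`, the coefficients `m` with which the relations produce their
difference satisfy the transposed equation `2 m(c) - m(c') - m(c'') = δ_x(c) - δ_y(c)`, where `c'`,
`c''` are the heads of the edges leaving `c`. By the maximum principle the set where `m` is maximal
contains `x`, omits `y` and has exactly one outgoing edge (`exists_cut`). By conservation of flow it
also has one incoming edge, so `D` is a diagrammatic connected sum along these two edges.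

This contradicts primeness once neither summand is an unknot. The summands are again connected,
reduced and alternating. If all arcs of such a diagram agreed in `Col`, any two crossings would be
separated by a cut with one outgoing edge; submodularity of cuts shrinks it to a single crossing,
which two edges leave. Hence the tautological coloring in `Col` is nonconstant
(`Reduced.hasNonconstantColoring_col`), while existence of nonconstant colorings is invariant under
Reidemeister moves and fails for the unknot. Planarity of the summands follows from a face count and
Euler's inequality (`Alternating.card_face_le`).

To pass to finite colors: killing the base arc identifies no two arcs, since all arcs have degree
`1`. The maximum principle for integral colorings excludes a nonzero homomorphism to `ℤ`, so `n₁ ≠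
0`. Each `ℤ/n_i` then embeds in `ℤ/n₁`, and the coordinates of the given isomorphism are the
required colorings. -/

noncomputable instance (D : PreDiagram) : Fintype D.Crossing := @Fintype.ofFinite _ D.finite

/-! ### Dart colorings in an abelian group -/

/-- A coloring of the darts with elements of an abelian group, constant on the arcs and satisfying
the Fox relation at each crossing. -/
structure IsDartColoring (D : PreDiagram) {A : Type} [AddCommGroup A] (f : D.Dart → A) :
    Prop where
  edge : ∀ d, f (D.opp d) = f d
  upper : ∀ x, f (x, 1) = f (x, 3)
  fox : ∀ x, f (x, 0) + f (x, 2) = f (x, 1) + f (x, 3)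

/-- There is a nonconstant Fox coloring with values in `A`, the crossingless components
included. -/
def HasNonconstantColoring (D : PreDiagram) (A : Type) [AddCommGroup A] : Prop :=
  ∃ (f : D.Dart → A) (g : Fin D.circles → A), D.IsDartColoring f ∧
    ¬ ∃ c, (∀ d, f d = c) ∧ ∀ i, g i = c

theorem zmod_four_cases (i : ZMod 4) : i = 0 ∨ i = 1 ∨ i = 2 ∨ i = 3 := by
  revert i; decide

/-! ### Invariance under isomorphism and the first Reidemeister moves -/

section Invariance

variable {A : Type}

/-- The involution of `D.reconnect p q`, as a function on the darts of `D`. -/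
noncomputable def reconnectOpp (D : PreDiagram) (p q : D.Dart) : D.Dart → D.Dart :=
  (D.reconnect p q).opp

open Classical in
theorem reconnectOpp_of_ne (D : PreDiagram) {p q : D.Dart} (h1 : q ≠ p) (h2 : q ≠ D.opp p) :
    D.reconnectOpp p q p = q ∧ D.reconnectOpp p q q = p ∧
    D.reconnectOpp p q (D.opp p) = D.opp q ∧ D.reconnectOpp p q (D.opp q) = D.opp p ∧
    ∀ d, d ≠ p → d ≠ q → d ≠ D.opp p → d ≠ D.opp q →
      D.reconnectOpp p q d = D.opp d := by
  have h3 : p ≠ D.opp q := fun h => h2 (by rw [h, D.opp_opp])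
  have h4 : D.opp p ≠ D.opp q := fun h => h1 (by rw [← D.opp_opp p, h, D.opp_opp])
  have hp := D.opp_ne p
  have hq := D.opp_ne q
  have hd : ∀ d, D.reconnectOpp p q d =
      Equiv.swap (D.opp p) q (D.opp (Equiv.swap (D.opp p) q d)) := fun d => by
    change Equiv.swap (D.opp p) q (D.opp ((Equiv.swap (D.opp p) q).symm d)) = _
    rw [Equiv.symm_swap]
  rw [hd, hd, hd, hd]
  refine ⟨?_, ?_, ?_, ?_, fun d e1 e2 e3 e4 => ?_⟩
  · rw [Equiv.swap_apply_of_ne_of_ne hp.symm h1.symm, Equiv.swap_apply_left]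
  · rw [Equiv.swap_apply_right, D.opp_opp, Equiv.swap_apply_of_ne_of_ne hp.symm h1.symm]
  · rw [Equiv.swap_apply_left, Equiv.swap_apply_of_ne_of_ne h4.symm hq]
  · rw [Equiv.swap_apply_of_ne_of_ne h4.symm hq, D.opp_opp, Equiv.swap_apply_right]
  · rw [hd, Equiv.swap_apply_of_ne_of_ne e3 e2, Equiv.swap_apply_of_ne_of_ne]
    · exact fun h => e1 (by rw [← D.opp_opp d, h, D.opp_opp])
    · exact fun h => e4 (by rw [← h, D.opp_opp])

theorem reconnect_edge_iff (D : PreDiagram) {p q : D.Dart} (h1 : q ≠ p) (h2 : q ≠ D.opp p)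
    (f : D.Dart → A) :
    (∀ d, f (D.reconnectOpp p q d) = f d) ↔
      f p = f q ∧ f (D.opp p) = f (D.opp q) ∧
      ∀ d, d ≠ p → d ≠ q → d ≠ D.opp p → d ≠ D.opp q → f (D.opp d) = f d := by
  obtain ⟨o1, o2, o3, o4, o5⟩ := D.reconnectOpp_of_ne h1 h2
  constructor
  · intro h
    refine ⟨?_, ?_, fun d e1 e2 e3 e4 => ?_⟩
    · have := h p; rw [o1] at this; exact this.symm
    · have := h (D.opp p); rw [o3] at this; exact this.symm
    · have := h d; rwa [o5 d e1 e2 e3 e4] at this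
  · rintro ⟨a1, a2, a3⟩ d
    by_cases e1 : d = p
    · rw [e1, o1, a1]
    by_cases e2 : d = q
    · rw [e2, o2, a1]
    by_cases e3 : d = D.opp p
    · rw [e3, o3, a2]
    by_cases e4 : d = D.opp q
    · rw [e4, o4, a2]
    rw [o5 d e1 e2 e3 e4, a3 d e1 e2 e3 e4]

theorem union_opp_inl (D E : PreDiagram) (d : D.Dart) :
    (D.union E).opp (inl E d) = inl E (D.opp d) := rfl

theorem union_opp_inr (D E : PreDiagram) (d : E.Dart) :
    (D.union E).opp (inr D d) = inr D (E.opp d) := rfl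

theorem inl_ne_inr {D E : PreDiagram} (d : D.Dart) (e : E.Dart) : inl E d ≠ inr D e :=
  fun h => Sum.inl_ne_inr (congrArg Prod.fst h)

theorem inl_injective {D E : PreDiagram} : Function.Injective (inl (D := D) E) := by
  rintro ⟨x, i⟩ ⟨y, j⟩ h
  obtain ⟨h1, h2⟩ := Prod.mk.inj h
  exact Prod.ext (Sum.inl.inj h1) h2

theorem inr_injective {D E : PreDiagram} : Function.Injective (inr D (E := E)) := by
  rintro ⟨x, i⟩ ⟨y, j⟩ h
  obtain ⟨h1, h2⟩ := Prod.mk.inj h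
  exact Prod.ext (Sum.inr.inj h1) h2

theorem union_dart_cases {D E : PreDiagram} (d : (D.union E).Dart) :
    (∃ a, d = inl E a) ∨ ∃ b, d = inr D b := by
  obtain ⟨x | x, i⟩ := d
  · exact .inl ⟨(x, i), rfl⟩
  · exact .inr ⟨(x, i), rfl⟩

/-- The function on the darts of a disjoint union with given restrictions. -/
def unionElim {D E : PreDiagram} (f : D.Dart → A) (g : E.Dart → A) (d : (D.union E).Dart) : A :=
  match d with
  | (Sum.inl x, i) => f (x, i)
  | (Sum.inr x, i) => g (x, i)



/-- The edge condition in a connected sum, in terms of the two summands. -/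
theorem connectedSum_edge_iff (D E : PreDiagram) (a : D.Dart) (b : E.Dart)
    (f : (D.union E).Dart → A) :
    (∀ d, f ((D.connectedSum E a b).opp d) = f d) ↔
      f (inl E a) = f (inr D b) ∧ f (inl E (D.opp a)) = f (inr D (E.opp b)) ∧
      (∀ d, d ≠ a → d ≠ D.opp a → f (inl E (D.opp d)) = f (inl E d)) ∧
      (∀ d, d ≠ b → d ≠ E.opp b → f (inr D (E.opp d)) = f (inr D d)) := by
  have := (D.union E).reconnect_edge_iff (p := inl E a) (q := inr D b)
    (inl_ne_inr _ _).symm (by rw [union_opp_inl]; exact (inl_ne_inr _ _).symm) f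
  refine this.trans ?_
  simp only [union_opp_inl, union_opp_inr]
  constructor
  · rintro ⟨h1, h2, h3⟩
    refine ⟨h1, h2, fun d e1 e2 => ?_, fun d e1 e2 => ?_⟩
    · exact h3 (inl E d) (inl_injective.ne e1) (inl_ne_inr _ _) (inl_injective.ne e2)
        (inl_ne_inr _ _)
    · exact h3 (inr D d) (inl_ne_inr _ _).symm (inr_injective.ne e1) (inl_ne_inr _ _).symm
        (inr_injective.ne e2)
  · rintro ⟨h1, h2, h3, h4⟩
    refine ⟨h1, h2, fun d e1 e2 e3 e4 => ?_⟩
    rcases union_dart_cases d with ⟨c, rfl⟩ | ⟨c, rfl⟩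
    · exact h3 c (fun h => e1 (h ▸ rfl)) (fun h => e3 (h ▸ rfl))
    · exact h4 c (fun h => e2 (h ▸ rfl)) (fun h => e4 (h ▸ rfl))

variable [AddCommGroup A]

/-- The bijection of the darts given by an isomorphism of diagrams. -/
def isoDarts {D E : PreDiagram} (e : D.Crossing ≃ E.Crossing) (r : D.Crossing → ZMod 4) :
    D.Dart ≃ E.Dart where
  toFun d := (e d.1, d.2 + r d.1)
  invFun d := (e.symm d.1, d.2 - r (e.symm d.1))
  left_inv d := by simp
  right_inv d := by simp

/-- A half turn at a crossing exchanges `0` with `2` and `1` with `3`, and both crossing conditions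
are symmetric under this. -/
theorem isDartColoring_comp_isoDarts {D E : PreDiagram} (e : D.Crossing ≃ E.Crossing)
    (r : D.Crossing → ZMod 4) (hr : ∀ x, r x = 0 ∨ r x = 2)
    (h : ∀ d : D.Dart, E.opp (e d.1, d.2 + r d.1) =
      (e (D.opp d).1, (D.opp d).2 + r (D.opp d).1)) (f : E.Dart → A) :
    D.IsDartColoring (f ∘ isoDarts e r) ↔ E.IsDartColoring f := by
  have h' : ∀ d : D.Dart, E.opp (isoDarts e r d) = isoDarts e r (D.opp d) := h
  have key : ∀ x : D.Crossing,
      ((f (e x, 1 + r x) = f (e x, 3 + r x)) ↔ f (e x, 1) = f (e x, 3)) ∧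
      ((f (e x, 0 + r x) + f (e x, 2 + r x) = f (e x, 1 + r x) + f (e x, 3 + r x)) ↔
        f (e x, 0) + f (e x, 2) = f (e x, 1) + f (e x, 3)) := by
    intro x
    rcases hr x with h0 | h2
    · simp [h0]
    · have e1 : (1 : ZMod 4) + 2 = 3 := by decide
      have e2 : (3 : ZMod 4) + 2 = 1 := by decide
      have e3 : (2 : ZMod 4) + 2 = 0 := by decide
      rw [h2, e1, e2, e3, zero_add, add_comm (f (e x, 2)), add_comm (f (e x, 3))]
      exact ⟨eq_comm, Iff.rfl⟩
  constructor
  · intro hf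
    refine ⟨fun d => ?_, fun y => ?_, fun y => ?_⟩
    · have := hf.edge ((isoDarts e r).symm d)
      simp only [Function.comp_apply, ← h', Equiv.apply_symm_apply] at this
      exact this
    · have := hf.upper (e.symm y)
      have h2 := (key (e.symm y)).1.1 this
      simpa using h2
    · have := hf.fox (e.symm y)
      have h2 := (key (e.symm y)).2.1 this
      simpa using h2
  · intro hf
    refine ⟨fun d => ?_, fun y => ?_, fun y => ?_⟩
    · simp only [Function.comp_apply, ← h', hf.edge]
    · exact (key y).1.2 (hf.upper (e y))
    · exact (key y).2.2 (hf.fox (e y))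

theorem Iso.hasNonconstantColoring_iff {D E : PreDiagram} (h : D.Iso E) :
    D.HasNonconstantColoring A ↔ E.HasNonconstantColoring A := by
  obtain ⟨hc, e, r, hr, ho⟩ := h
  constructor
  · rintro ⟨f, g, hf, hn⟩
    refine ⟨f ∘ (isoDarts e r).symm, g ∘ Fin.cast hc.symm, ?_, ?_⟩
    · rw [← isDartColoring_comp_isoDarts e r hr ho]
      simpa [Function.comp_assoc] using hf
    · rintro ⟨c, h1, h2⟩
      refine hn ⟨c, fun d => ?_, fun i => ?_⟩
      · simpa using h1 (isoDarts e r d)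
      · simpa using h2 (Fin.cast hc i)
  · rintro ⟨f, g, hf, hn⟩
    refine ⟨f ∘ isoDarts e r, g ∘ Fin.cast hc,
      (isDartColoring_comp_isoDarts e r hr ho f).2 hf, ?_⟩
    rintro ⟨c, h1, h2⟩
    refine hn ⟨c, fun d => ?_, fun i => ?_⟩
    · simpa using h1 ((isoDarts e r).symm d)
    · simpa using h2 (Fin.cast hc.symm i)

/-- Only the edge of `b` may be cut. The other edge of the curl joins a lower dart to an upper one,
so that lower dart has the color of the upper strand, and the Fox relation gives the same color to
the other lower dart. -/
theorem curl_coloring {i : ZMod 4} {b : (curl i).Dart} {f : (curl i).Dart → A}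
    (h : ∀ d, d ≠ b → d ≠ (curl i).opp b → f ((curl i).opp d) = f d)
    (h1 : ∀ x, f (x, 1) = f (x, 3)) (h2 : ∀ x, f (x, 0) + f (x, 2) = f (x, 1) + f (x, 3)) :
    ∀ d, f d = f b := by
  have h1' := h1 ()
  have h2' := h2 ()
  have h' : ∀ j : ZMod 4, j ≠ b.2 → j ≠ 2 * i + 1 - b.2 → f ((), 2 * i + 1 - j) = f ((), j) :=
    fun j e1 e2 => h ((), j) (fun e => e1 (e ▸ rfl)) (fun e => e2 (congrArg Prod.snd e))
  obtain ⟨u, j⟩ := b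
  suffices hs : f ((), 0) = f ((), 1) ∧ f ((), 2) = f ((), 1) by
    rintro ⟨v, k⟩
    have : ∀ k, f ((), k) = f ((), 1) := by
      intro k
      rcases zmod_four_cases k with rfl | rfl | rfl | rfl
      exacts [hs.1, rfl, hs.2, h1'.symm]
    exact (this k).trans (this j).symm
  have key : (f ((), 0) = f ((), 1) ∨ f ((), 2) = f ((), 1)) := by
    have e : ∀ k : ZMod 4, k ≠ j → k ≠ 2 * i + 1 - j → (k = 0 ∨ k = 2) →
        f ((), k) = f ((), 1) := by
      intro k k1 k2 k3
      have hk := h' k k1 k2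
      have : 2 * i + 1 - k = 1 ∨ 2 * i + 1 - k = 3 := by
        exact (by decide : ∀ i k : ZMod 4, (k = 0 ∨ k = 2) →
          2 * i + 1 - k = 1 ∨ 2 * i + 1 - k = 3) i k k3
      rcases this with e | e <;> rw [e] at hk
      · exact hk.symm
      · rw [← hk, h1']
    -- The two lower darts lie on different edges, as `opp` changes parity; so one of them is not on
    -- the cut edge.
    have : (0 ≠ j ∧ 0 ≠ 2 * i + 1 - j) ∨ ((2 : ZMod 4) ≠ j ∧ 2 ≠ 2 * i + 1 - j) :=
      (by decide : ∀ i j : ZMod 4, (0 ≠ j ∧ 0 ≠ 2 * i + 1 - j) ∨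
        ((2 : ZMod 4) ≠ j ∧ 2 ≠ 2 * i + 1 - j)) i j
    rcases this with t | t
    · exact .inl (e 0 t.1 t.2 (.inl rfl))
    · exact .inr (e 2 t.1 t.2 (.inr rfl))
  rw [← h1'] at h2'
  rcases key with k | k
  · refine ⟨k, ?_⟩
    rw [k] at h2'; exact add_left_cancel h2'
  · refine ⟨?_, k⟩
    rw [k] at h2'; exact add_right_cancel h2'

/-- A coloring extends over the curl by the color of the edge carrying it; conversely the curl is
monochromatic, so the two ends of that edge agree. -/
theorem R1.hasNonconstantColoring_iff {D E : PreDiagram} (h : D.R1 E) :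
    D.HasNonconstantColoring A ↔ E.HasNonconstantColoring A := by
  obtain ⟨i, a, b, hi⟩ := h
  rw [← hi.hasNonconstantColoring_iff]
  constructor
  · rintro ⟨f, g, hf, hn⟩
    let F : (D.union (curl i)).Dart → A := unionElim f fun _ => f a
    refine ⟨F, g, ⟨?_, ?_, ?_⟩, ?_⟩
    · exact (connectedSum_edge_iff D (curl i) a b F).2
        ⟨rfl, hf.edge a, fun d _ _ => hf.edge d, fun _ _ _ => rfl⟩
    · rintro (x | x)
      exacts [hf.upper x, rfl]
    · rintro (x | x)
      exacts [hf.fox x, rfl]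
    · rintro ⟨c, h1, h2⟩
      exact hn ⟨c, fun d => h1 (inl _ d), h2⟩
  · rintro ⟨f, g, hf, hn⟩
    have hf1 := hf.edge
    have hf2 : ∀ x : D.Crossing ⊕ (curl i).Crossing, f (x, 1) = f (x, 3) := hf.upper
    have hf3 : ∀ x : D.Crossing ⊕ (curl i).Crossing,
      f (x, 0) + f (x, 2) = f (x, 1) + f (x, 3) := hf.fox
    obtain ⟨h1, h2, h3, h4⟩ := (connectedSum_edge_iff D (curl i) a b f).1 hf1
    have h5 := curl_coloring (f := fun d => f (inr D d)) h4 (fun x => hf2 (Sum.inr x))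
      (fun x => hf3 (Sum.inr x))
    have h6 : f (inl (curl i) (D.opp a)) = f (inl (curl i) a) := by
      rw [h1, h2, h5]
    refine ⟨fun d => f (inl (curl i) d), g, ⟨fun d => ?_, fun x => hf2 (Sum.inl x),
      fun x => hf3 (Sum.inl x)⟩, ?_⟩
    · by_cases e1 : d = a
      · subst e1; exact h6
      by_cases e2 : d = D.opp a
      · subst e2; rw [D.opp_opp]; exact h6.symm
      exact h3 d e1 e2
    · rintro ⟨c, c1, c2⟩
      refine hn ⟨c, fun d => ?_, c2⟩
      rcases union_dart_cases d with ⟨d, rfl⟩ | ⟨d, rfl⟩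
      · exact c1 d
      · exact (h5 d).trans (h1.symm.trans (c1 a))

theorem R1Circle.hasNonconstantColoring_iff {D E : PreDiagram} (h : D.R1Circle E) :
    D.HasNonconstantColoring A ↔ E.HasNonconstantColoring A := by
  obtain ⟨F, i, h1, h2⟩ := h
  rw [← h1.hasNonconstantColoring_iff, ← h2.hasNonconstantColoring_iff]
  constructor
  · rintro ⟨f, g, hf, hn⟩
    have hf1 : ∀ d, f (inl circle (F.opp d)) = f (inl circle d) := fun d => hf.edge (inl circle d)
    have hf2 : ∀ x : F.Crossing ⊕ circle.Crossing, f (x, 1) = f (x, 3) := hf.upper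
    have hf3 : ∀ x : F.Crossing ⊕ circle.Crossing,
      f (x, 0) + f (x, 2) = f (x, 1) + f (x, 3) := hf.fox
    change Fin (F.circles + 1) → A at g
    -- The last index of `Fin (F.circles + 1)` is the circle that becomes the curl; its color is
    -- spread over the curl.
    let G : (F.union (curl i)).Dart → A :=
      unionElim (fun d => f (inl circle d)) fun _ => g (Fin.last _)
    refine ⟨G, fun j => g (Fin.castSucc j), ⟨?_, ?_, ?_⟩, ?_⟩
    · rintro ⟨x | x, j⟩
      exacts [hf1 (x, j), rfl]
    · rintro (x | x)
      exacts [hf2 (Sum.inl x), rfl]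
    · rintro (x | x)
      exacts [hf3 (Sum.inl x), rfl]
    · rintro ⟨c, c1, c2⟩
      refine hn ⟨c, fun d => ?_, fun j => ?_⟩
      · rcases union_dart_cases d with ⟨d, rfl⟩ | ⟨d, rfl⟩
        · exact c1 (inl _ d)
        · exact d.1.elim
      · refine Fin.lastCases ?_ (fun j => ?_) j
        · exact c1 (inr F ((), 0))
        · exact c2 j
  · rintro ⟨f, g, hf, hn⟩
    have hf1 : ∀ d, f (inl (curl i) (F.opp d)) = f (inl (curl i) d) :=
      fun d => hf.edge (inl (curl i) d)
    have hf1' : ∀ d, f (inr F ((curl i).opp d)) = f (inr F d) := fun d => hf.edge (inr F d)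
    have hf2 : ∀ x : F.Crossing ⊕ (curl i).Crossing, f (x, 1) = f (x, 3) := hf.upper
    have hf3 : ∀ x : F.Crossing ⊕ (curl i).Crossing,
      f (x, 0) + f (x, 2) = f (x, 1) + f (x, 3) := hf.fox
    change Fin F.circles → A at g
    have h5 := curl_coloring (b := ((), 0)) (f := fun d => f (inr F d)) (fun d _ _ => hf1' d)
      (fun x => hf2 (Sum.inr x)) (fun x => hf3 (Sum.inr x))
    let G : (F.union circle).Dart → A := unionElim (fun d => f (inl (curl i) d)) fun d => d.1.elim
    refine ⟨G, (Fin.snoc (α := fun _ => A) g (f (inr F ((), 0))) : Fin (F.circles + 1) → A),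
      ⟨?_, ?_, ?_⟩, ?_⟩
    · rintro ⟨x | x, j⟩
      exacts [hf1 (x, j), x.elim]
    · rintro (x | x)
      exacts [hf2 (Sum.inl x), x.elim]
    · rintro (x | x)
      exacts [hf3 (Sum.inl x), x.elim]
    · rintro ⟨c, c1, c2⟩
      refine hn ⟨c, fun d => ?_, fun j => ?_⟩
      · rcases union_dart_cases d with ⟨d, rfl⟩ | ⟨d, rfl⟩
        · exact c1 (inl _ d)
        · refine (h5 d).trans ?_
          have := c2 (Fin.last F.circles)
          simpa using this
      · have := c2 (Fin.castSucc (n := F.circles) j)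
        exact (Fin.snoc_castSucc (α := fun _ => A) _ g j).symm.trans this

end Invariance

/-! ### Invariance under the second Reidemeister move -/

section Invariance

variable {A : Type}

/-- The edge condition after a second Reidemeister move. -/
theorem R2_edge_iff (D : PreDiagram) {a b : D.Dart} (hba : b ≠ a) (hba' : b ≠ D.opp a)
    (f : D.Dart → A) (g : ZMod 4 → A) (h : ZMod 4 → A) :
    let O := overlappingCircles
    let F : (D.union O).Dart → A := unionElim f fun d : Bool × ZMod 4 =>
      if d.1 then h d.2 else g d.2
    (∀ d, F ((((D.union O).reconnect (inl O a) (inr (E := O) D (false, 3))).reconnect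
        (inl O b) (inr (E := O) D (false, 0))).opp d) = F d) ↔
      f a = g 3 ∧ f (D.opp a) = h 1 ∧ f b = g 0 ∧ f (D.opp b) = h 0 ∧ g 1 = h 3 ∧ g 2 = h 2 ∧
      ∀ d, d ≠ a → d ≠ D.opp a → d ≠ b → d ≠ D.opp b → f (D.opp d) = f d := by
  intro O F
  let U := D.union O
  let a' : U.Dart := inl O a
  let b' : U.Dart := inl O b
  let r : Bool → ZMod 4 → U.Dart := fun x i => inr (E := O) D (x, i)
  have hr : ∀ {x y i j}, (x, i) ≠ (y, j) → r x i ≠ r y j := fun h => inr_injective.ne h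
  have hlr : ∀ d x i, inl O d ≠ r x i := fun d x i => inl_ne_inr _ _
  have hF : ∀ x i, F (r x i) = if x then h i else g i := fun _ _ => rfl
  have hro : ∀ x i, U.opp (r x i) = r (!x) (-i) := fun _ _ => rfl
  have hlo : ∀ d, U.opp (inl O d) = inl O (D.opp d) := fun _ => rfl
  have n3 : -(3 : ZMod 4) = 1 := by decide
  have n2 : -(2 : ZMod 4) = 2 := by decide
  have n1 : -(1 : ZMod 4) = 3 := by decide
  have n0 : -(0 : ZMod 4) = 0 := by decide
  have hab : D.opp b ≠ a := fun e => hba' (by rw [← e, D.opp_opp])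
  have hab' : D.opp b ≠ D.opp a := fun e => hba (by rw [← D.opp_opp b, e, D.opp_opp])
  obtain ⟨o1, o2, o3, o4, o5⟩ := U.reconnectOpp_of_ne (p := a') (q := r false 3)
    (hlr _ _ _).symm (by rw [hlo]; exact (hlr _ _ _).symm)
  rw [hlo] at o3 o4 o5
  rw [hro, n3, Bool.not_false] at o3 o4 o5
  -- The second cut does not interfere with the first: the edge at `b` and the lower edge between
  -- the new crossings are untouched by the first reconnection.
  have ob : U.reconnectOpp a' (r false 3) b' = inl O (D.opp b) :=
    o5 b' (inl_injective.ne hba) (hlr _ _ _) (inl_injective.ne hba') (hlr _ _ _)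
  have o0 : U.reconnectOpp a' (r false 3) (r false 0) = r true 0 :=
    (o5 (r false 0) (hlr _ _ _).symm (hr (by decide)) (hlr _ _ _).symm (hr (by decide))).trans
      (by rw [hro, n0, Bool.not_false])
  have key := (U.reconnect a' (r false 3)).reconnect_edge_iff (p := b') (q := r false 0)
    (hlr _ _ _).symm (fun e => by
      have : r false 0 = U.reconnectOpp a' (r false 3) b' := e
      rw [ob] at this; exact hlr _ _ _ this.symm) F
  change _ ↔ (F b' = F (r false 0) ∧ F (U.reconnectOpp a' (r false 3) b') =
    F (U.reconnectOpp a' (r false 3) (r false 0)) ∧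
    ∀ d : U.Dart, d ≠ b' → d ≠ r false 0 → d ≠ U.reconnectOpp a' (r false 3) b' →
      d ≠ U.reconnectOpp a' (r false 3) (r false 0) →
      F (U.reconnectOpp a' (r false 3) d) = F d) at key
  rw [ob, o0] at key
  refine key.trans ?_
  constructor
  · rintro ⟨k1, k2, k3⟩
    refine ⟨?_, ?_, k1, k2, ?_, ?_, ?_⟩
    · have := k3 a' (inl_injective.ne hba.symm) (hlr _ _ _) (inl_injective.ne hab.symm) (hlr _ _ _)
      rw [o1] at this; exact this.symm
    · have := k3 (r true 1) (hlr _ _ _).symm (hr (by decide)) (hlr _ _ _).symm (hr (by decide))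
      rw [o4] at this; exact this
    · have := k3 (r false 1) (hlr _ _ _).symm (hr (by decide)) (hlr _ _ _).symm (hr (by decide))
      rw [o5 (r false 1) (hlr _ _ _).symm (hr (by decide)) (hlr _ _ _).symm (hr (by decide)),
        hro, n1] at this
      exact this.symm
    · have := k3 (r false 2) (hlr _ _ _).symm (hr (by decide)) (hlr _ _ _).symm (hr (by decide))
      rw [o5 (r false 2) (hlr _ _ _).symm (hr (by decide)) (hlr _ _ _).symm (hr (by decide)),
        hro, n2] at this
      exact this.symm
    · intro d e1 e2 e3 e4
      have := k3 (inl O d) (inl_injective.ne e3) (hlr _ _ _) (inl_injective.ne e4) (hlr _ _ _)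
      rw [o5 (inl O d) (inl_injective.ne e1) (hlr _ _ _) (inl_injective.ne e2) (hlr _ _ _),
        hlo] at this
      exact this
  · rintro ⟨k1, k2, k3, k4, k5, k6, k7⟩
    refine ⟨k3, k4, fun d e1 e2 e3 e4 => ?_⟩
    by_cases d1 : d = a'
    · rw [d1, o1]; exact k1.symm
    by_cases d2 : d = r false 3
    · rw [d2, o2]; exact k1
    by_cases d3 : d = inl O (D.opp a)
    · rw [d3, o3]; exact k2.symm
    by_cases d4 : d = r true 1
    · rw [d4, o4]; exact k2
    rw [o5 d d1 d2 d3 d4]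
    rcases union_dart_cases d with ⟨d, rfl⟩ | ⟨⟨x, i⟩, rfl⟩
    · rw [hlo]
      exact k7 d (fun e => d1 (e ▸ rfl)) (fun e => d3 (e ▸ rfl)) (fun e => e1 (e ▸ rfl))
        (fun e => e3 (e ▸ rfl))
    · change Bool at x
      change F (U.opp (r x i)) = F (r x i)
      rw [hro, hF, hF]
      rcases zmod_four_cases i with rfl | rfl | rfl | rfl <;> cases x <;>
        simp only [n0, n1, n2, n3, Bool.not_true, Bool.not_false, if_true, Bool.false_eq_true,
          if_false, k5, k6]
      exacts [absurd rfl e2, absurd rfl e4, absurd rfl d4, absurd rfl d2]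

variable [AddCommGroup A]

/-- The strand of `b` is reflected in the color of `a` at one new crossing and reflected back at the
other. -/
theorem R2.hasNonconstantColoring_iff {D E : PreDiagram} (h : D.R2 E) :
    D.HasNonconstantColoring A ↔ E.HasNonconstantColoring A := by
  obtain ⟨a, b, hba, hba', hi⟩ := h
  rw [← hi.hasNonconstantColoring_iff]
  constructor
  · rintro ⟨f, c, hf, hn⟩
    -- The same colors serve at both crossings: `f a` above, `f b` outside the bigon, and the
    -- reflected color `2 f a - f b` inside it.
    let g : ZMod 4 → A := fun i => if i = 0 then f b else if i = 2 then f a + f a - f b else f a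
    have g0 : g 0 = f b := rfl
    have g1 : g 1 = f a := rfl
    have g2 : g 2 = f a + f a - f b := rfl
    have g3 : g 3 = f a := rfl
    refine ⟨unionElim f fun d : Bool × ZMod 4 => if d.1 then g d.2 else g d.2, c,
      ⟨(R2_edge_iff D hba hba' f g g).2 ?_, ?_, ?_⟩, ?_⟩
    · rw [g0, g1, g2, g3, hf.edge, hf.edge]
      exact ⟨rfl, rfl, rfl, rfl, rfl, rfl, fun d _ _ _ _ => hf.edge d⟩
    · rintro (x | x)
      · exact hf.upper x
      · cases x <;> rfl
    · rintro (x | x)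
      · exact hf.fox x
      · have : g 0 + g 2 = g 1 + g 3 := by rw [g0, g1, g2, g3]; abel
        cases x <;> exact this
    · rintro ⟨c, h1, h2⟩
      exact hn ⟨c, fun d => h1 (inl overlappingCircles d), h2⟩
  · rintro ⟨f, c, hf, hn⟩
    have hf2 : ∀ x : D.Crossing ⊕ Bool, f (x, 1) = f (x, 3) := hf.upper
    have hf3 : ∀ x : D.Crossing ⊕ Bool, f (x, 0) + f (x, 2) = f (x, 1) + f (x, 3) := hf.fox
    let f' : D.Dart → A := fun d => f (inl overlappingCircles d)
    let g : ZMod 4 → A := fun i => f (inr (E := overlappingCircles) D (false, i))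
    let h : ZMod 4 → A := fun i => f (inr (E := overlappingCircles) D (true, i))
    have hfe : f = unionElim f' fun d : Bool × ZMod 4 => if d.1 then h d.2 else g d.2 := by
      funext d
      obtain ⟨x | x, i⟩ := d
      · rfl
      · cases x <;> rfl
    have h1 := hf.edge
    rw [hfe] at h1
    obtain ⟨k1, k2, k3, k4, k5, k6, k7⟩ := (R2_edge_iff D hba hba' f' g h).1 h1
    have g1 : g 1 = g 3 := hf2 (Sum.inr false)
    have g2 : g 0 + g 2 = g 1 + g 3 := hf3 (Sum.inr false)
    have h1 : h 1 = h 3 := hf2 (Sum.inr true)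
    have h2 : h 0 + h 2 = h 1 + h 3 := hf3 (Sum.inr true)
    have ha : f' (D.opp a) = f' a := by rw [k1, k2, h1, ← k5, g1]
    have hb : f' (D.opp b) = f' b := by
      rw [k3, k4]
      apply add_right_cancel (b := g 2)
      rw [g2, k6, h2, h1, k5, ← g1, k5]
    refine ⟨f', c, ⟨fun d => ?_, fun x => hf2 (Sum.inl x), fun x => hf3 (Sum.inl x)⟩, ?_⟩
    · by_cases d1 : d = a
      · rw [d1, ha]
      by_cases d2 : d = D.opp a
      · rw [d2, D.opp_opp, ha]
      by_cases d3 : d = b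
      · rw [d3, hb]
      by_cases d4 : d = D.opp b
      · rw [d4, D.opp_opp, hb]
      exact k7 d d1 d2 d3 d4
    · rintro ⟨c, c1, c2⟩
      have e3 : g 3 = c := by rw [← k1, c1]
      have e1 : g 1 = c := by rw [g1, e3]
      have e0 : g 0 = c := by rw [← k3, c1]
      have e2 : g 2 = c := by
        rw [e0, e1, e3] at g2; exact add_left_cancel g2
      have t1 : h 1 = c := by rw [← k2, c1]
      have t3 : h 3 = c := by rw [← h1, t1]
      have t0 : h 0 = c := by rw [← k4, c1]
      have t2 : h 2 = c := by rw [← k6, e2]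
      refine hn ⟨c, fun d => ?_, c2⟩
      rcases union_dart_cases d with ⟨d, rfl⟩ | ⟨⟨x, i⟩, rfl⟩
      · exact c1 d
      · rcases zmod_four_cases i with rfl | rfl | rfl | rfl <;> cases x
        exacts [e0, t0, e1, t1, e2, t2, e3, t3]


/-! ### Invariance under the third Reidemeister move -/

/-- A triangle of edges, with the permutation of the darts used in a third Reidemeister move. -/
structure Triangle (D : PreDiagram) (x₁ x₂ x₃ : D.Crossing) (i₁ i₂ i₃ : ZMod 4)
    (τ : Equiv.Perm D.Dart) : Prop where
  ne₁ : x₁ ≠ x₂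
  ne₂ : x₂ ≠ x₃
  ne₃ : x₃ ≠ x₁
  odd : i₁ = 1 ∨ i₁ = 3
  even : i₂ = 0 ∨ i₂ = 2
  opp₁ : D.opp (x₁, i₁) = (x₂, i₂ + 1)
  opp₂ : D.opp (x₂, i₂) = (x₃, i₃ + 1)
  opp₃ : D.opp (x₃, i₃) = (x₁, i₁ + 1)
  inner₁ : τ (x₁, i₁) = (x₂, i₂ + 3)
  inner₂ : τ (x₂, i₂) = (x₃, i₃ + 3)
  inner₃ : τ (x₃, i₃) = (x₁, i₁ + 3)
  outer₁ : τ (x₁, i₁ + 2) = (x₂, i₂ + 1)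
  outer₂ : τ (x₂, i₂ + 2) = (x₃, i₃ + 1)
  outer₃ : τ (x₃, i₃ + 2) = (x₁, i₁ + 1)
  fixed : ∀ d : D.Dart, d.1 ≠ x₁ → d.1 ≠ x₂ → d.1 ≠ x₃ → τ d = d
  invol : ∀ d, τ (τ d) = d

theorem zmod_four_cases_add (i j : ZMod 4) : j = i ∨ j = i + 1 ∨ j = i + 2 ∨ j = i + 3 := by
  revert i j; decide

theorem fox_iff_of_odd {D : PreDiagram} (f : D.Dart → A) (x : D.Crossing) {i : ZMod 4}
    (hi : i = 1 ∨ i = 3) :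
    (f (x, 1) = f (x, 3) ∧ f (x, 0) + f (x, 2) = f (x, 1) + f (x, 3)) ↔
    (f (x, i) = f (x, i + 2) ∧ f (x, i + 1) + f (x, i + 3) = f (x, i) + f (x, i + 2)) := by
  have e1 : (1 : ZMod 4) + 1 = 2 := by decide
  have e2 : (1 : ZMod 4) + 2 = 3 := by decide
  have e3 : (1 : ZMod 4) + 3 = 0 := by decide
  have e4 : (3 : ZMod 4) + 1 = 0 := by decide
  have e5 : (3 : ZMod 4) + 2 = 1 := by decide
  have e6 : (3 : ZMod 4) + 3 = 2 := by decide
  rcases hi with rfl | rfl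
  · rw [e1, e2, e3, add_comm (f (x, 0))]
  · rw [e4, e5, e6, eq_comm (a := f (x, 1)), add_comm (f (x, 1))]

theorem fox_iff_of_even {D : PreDiagram} (f : D.Dart → A) (x : D.Crossing) {i : ZMod 4}
    (hi : i = 0 ∨ i = 2) :
    (f (x, 1) = f (x, 3) ∧ f (x, 0) + f (x, 2) = f (x, 1) + f (x, 3)) ↔
    (f (x, i + 1) = f (x, i + 3) ∧ f (x, i) + f (x, i + 2) = f (x, i + 1) + f (x, i + 3)) := by
  have e1 : (2 : ZMod 4) + 1 = 3 := by decide
  have e2 : (2 : ZMod 4) + 2 = 0 := by decide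
  have e3 : (2 : ZMod 4) + 3 = 1 := by decide
  rcases hi with rfl | rfl
  · simp only [zero_add]
  · rw [e1, e2, e3, add_comm (f (x, 0)), eq_comm (a := f (x, 1)), add_comm (f (x, 1))]

namespace Triangle

variable {D : PreDiagram} {x₁ x₂ x₃ : D.Crossing} {i₁ i₂ i₃ : ZMod 4} {τ : Equiv.Perm D.Dart}

/-- The colors outside the triangle are kept and only its three edges are recolored. The top strand
has one color `w₁` throughout, and each other strand is reflected in `w₁` where it passes below;
reflections preserve the Fox relation at the third crossing. -/
theorem hasNonconstantColoring_conj (T : D.Triangle x₁ x₂ x₃ i₁ i₂ i₃ τ)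
    (hD : D.HasNonconstantColoring A) : (D.conj τ).HasNonconstantColoring A := by
  classical
  obtain ⟨f, g, hf, hn⟩ := hD
  obtain ⟨n₁, n₂, n₃, odd, even, o₁, o₂, o₃, s₁, s₂, s₃, t₁, t₂, t₃, fix, inv⟩ := T
  have o₁' : D.opp (x₂, i₂ + 1) = (x₁, i₁) := by rw [← o₁, D.opp_opp]
  have o₂' : D.opp (x₃, i₃ + 1) = (x₂, i₂) := by rw [← o₂, D.opp_opp]
  have o₃' : D.opp (x₁, i₁ + 1) = (x₃, i₃) := by rw [← o₃, D.opp_opp]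
  have s₁' : τ (x₂, i₂ + 3) = (x₁, i₁) := by rw [← s₁, inv]
  have s₂' : τ (x₃, i₃ + 3) = (x₂, i₂) := by rw [← s₂, inv]
  have s₃' : τ (x₁, i₁ + 3) = (x₃, i₃) := by rw [← s₃, inv]
  have t₁' : τ (x₂, i₂ + 1) = (x₁, i₁ + 2) := by rw [← t₁, inv]
  have t₂' : τ (x₃, i₃ + 1) = (x₂, i₂ + 2) := by rw [← t₂, inv]
  have t₃' : τ (x₁, i₁ + 1) = (x₃, i₃ + 2) := by rw [← t₃, inv]
  have e₁ := hf.edge (x₁, i₁)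
  have e₂ := hf.edge (x₂, i₂)
  have e₃ := hf.edge (x₃, i₃)
  rw [o₁] at e₁
  rw [o₂] at e₂
  rw [o₃] at e₃
  obtain ⟨c₁, d₁⟩ := (fox_iff_of_odd f x₁ odd).1 ⟨hf.upper x₁, hf.fox x₁⟩
  obtain ⟨c₂, d₂⟩ := (fox_iff_of_even f x₂ even).1 ⟨hf.upper x₂, hf.fox x₂⟩
  -- `w₁` is the color of the top strand; `w₂`, `w₃` are forced by the relations at the moved
  -- crossings `x₂`, `x₁`.
  let w₁ := f (x₁, i₁ + 2)
  let w₂ := w₁ + w₁ - f (x₃, i₃ + 3)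
  let w₃ := w₁ + w₁ - f (x₃, i₃ + 2)
  -- Here `h` is constant on the edges of `D`; the coloring of `D.conj τ` is `h ∘ τ`, because its
  -- edges are the `τ`-images of those of `D`.
  let h : D.Dart → A := fun d =>
    if d = (x₁, i₁) ∨ d = (x₂, i₂ + 1) then w₁ else
    if d = (x₂, i₂) ∨ d = (x₃, i₃ + 1) then w₂ else
    if d = (x₃, i₃) ∨ d = (x₁, i₁ + 1) then w₃ else f d
  have z1 : (1 : ZMod 4) ≠ 0 := by decide
  have z2 : (2 : ZMod 4) ≠ 0 := by decide
  have z3 : (3 : ZMod 4) ≠ 0 := by decide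
  have z21 : (2 : ZMod 4) ≠ 1 := by decide
  have z31 : (3 : ZMod 4) ≠ 1 := by decide
  have h10 : h (x₁, i₁) = w₁ := by simp [h]
  have h11 : h (x₁, i₁ + 1) = w₃ := by simp [h, n₁, n₃.symm, z1]
  have h12 : h (x₁, i₁ + 2) = f (x₁, i₁ + 2) := by simp [h, n₁, n₃.symm, z2, z21]
  have h13 : h (x₁, i₁ + 3) = f (x₁, i₁ + 3) := by simp [h, n₁, n₃.symm, z3, z31]
  have h20 : h (x₂, i₂) = w₂ := by simp [h, n₁.symm, n₂, z1]
  have h21 : h (x₂, i₂ + 1) = w₁ := by simp [h]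
  have h22 : h (x₂, i₂ + 2) = f (x₂, i₂ + 2) := by simp [h, n₁.symm, n₂, z2, z21]
  have h23 : h (x₂, i₂ + 3) = f (x₂, i₂ + 3) := by simp [h, n₁.symm, n₂, z3, z31]
  have h30 : h (x₃, i₃) = w₃ := by simp [h, n₃, n₂.symm, z1]
  have h31 : h (x₃, i₃ + 1) = w₂ := by simp [h, n₃, n₂.symm]
  have h32 : h (x₃, i₃ + 2) = f (x₃, i₃ + 2) := by simp [h, n₃, n₂.symm, z2, z21]
  have h33 : h (x₃, i₃ + 3) = f (x₃, i₃ + 3) := by simp [h, n₃, n₂.symm, z3, z31]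
  have hel : ∀ d, d ≠ (x₁, i₁) → d ≠ (x₂, i₂ + 1) → d ≠ (x₂, i₂) → d ≠ (x₃, i₃ + 1) →
      d ≠ (x₃, i₃) → d ≠ (x₁, i₁ + 1) → h d = f d := by
    intro d a1 a2 a3 a4 a5 a6
    simp only [h, a1, a2, a3, a4, a5, a6, or_self, if_false]
  have hedge : ∀ d, h (D.opp d) = h d := by
    intro d
    by_cases a1 : d = (x₁, i₁)
    · rw [a1, o₁, h10, h21]
    by_cases a2 : d = (x₂, i₂ + 1)
    · rw [a2, o₁', h10, h21]
    by_cases a3 : d = (x₂, i₂)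
    · rw [a3, o₂, h20, h31]
    by_cases a4 : d = (x₃, i₃ + 1)
    · rw [a4, o₂', h20, h31]
    by_cases a5 : d = (x₃, i₃)
    · rw [a5, o₃, h30, h11]
    by_cases a6 : d = (x₁, i₁ + 1)
    · rw [a6, o₃', h30, h11]
    have q : ∀ {d' d''}, D.opp d'' = d' → d ≠ d'' → D.opp d ≠ d' := fun h1 h2 h3 =>
      h2 (by rw [← D.opp_opp d, h3, ← h1, D.opp_opp])
    rw [hel d a1 a2 a3 a4 a5 a6, hel _ (q o₁' a2) (q o₁ a1) (q o₂' a4) (q o₂ a3) (q o₃' a6)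
      (q o₃ a5), hf.edge]
  have hfox : ∀ x, (h (τ (x, 1)) = h (τ (x, 3)) ∧
      h (τ (x, 0)) + h (τ (x, 2)) = h (τ (x, 1)) + h (τ (x, 3))) := by
    intro x
    by_cases a1 : x = x₁
    · subst a1
      refine (fox_iff_of_odd (fun d => h (τ d)) x odd).2 ?_
      rw [s₁, t₁, t₃', s₃', h23, h21, h32, h30, ← c₂, e₁, c₁]
      exact ⟨rfl, by simp only [w₁, w₃]; abel⟩
    by_cases a2 : x = x₂
    · subst a2
      refine (fox_iff_of_even (fun d => h (τ d)) x even).2 ?_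
      rw [s₁', t₁', t₂, s₂, h10, h12, h33, h31]
      exact ⟨rfl, by simp only [w₁, w₂]; abel⟩
    by_cases a3 : x = x₃
    · subst a3
      -- In the old diagram too, the inner colors at `x₃` are reflections in `w₁` of the outer ones
      -- beyond the top strand.
      have dd1 : f (x, i₃) + f (x₁, i₁ + 3) = w₁ + w₁ := by rw [← e₃, d₁, c₁]
      have dd2 : f (x, i₃ + 1) + f (x₂, i₂ + 2) = w₁ + w₁ := by rw [e₂, d₂, ← c₂, e₁, c₁]
      -- Which of the two lower strands is above the other at `x₃` is not prescribed.
      have hi : (i₃ = 1 ∨ i₃ = 3) ∨ (i₃ = 0 ∨ i₃ = 2) := by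
        rcases zmod_four_cases i₃ with j | j | j | j <;> simp [j]
      rcases hi with hi | hi
      · obtain ⟨c₃, d₃⟩ := (fox_iff_of_odd f x hi).1 ⟨hf.upper x, hf.fox x⟩
        refine (fox_iff_of_odd (fun d => h (τ d)) x hi).2 ?_
        rw [s₃, t₃, t₂', s₂', h13, h11, h22, h20]
        refine ⟨?_, ?_⟩
        · simp only [w₃]
          linear_combination (norm := module) dd1 - c₃
        · simp only [w₂, w₃]
          linear_combination (norm := module) dd2 - d₃ - dd1
      · obtain ⟨c₃, d₃⟩ := (fox_iff_of_even f x hi).1 ⟨hf.upper x, hf.fox x⟩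
        refine (fox_iff_of_even (fun d => h (τ d)) x hi).2 ?_
        rw [s₃, t₃, t₂', s₂', h13, h11, h22, h20]
        refine ⟨?_, ?_⟩
        · simp only [w₂]
          linear_combination (norm := module) dd2 - c₃
        · simp only [w₂, w₃]
          linear_combination (norm := module) dd1 - d₃ - dd2
    · have hx : ∀ i, h (τ (x, i)) = f (x, i) := by
        intro i
        rw [fix (x, i) a1 a2 a3, hel] <;> rintro ⟨⟩ <;> contradiction
      rw [hx, hx, hx, hx]
      exact ⟨hf.upper x, hf.fox x⟩
  have hsymm : ∀ d, τ.symm d = τ d := fun d => by rw [Equiv.symm_apply_eq, inv]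
  refine ⟨fun d => h (τ d), g, ⟨fun d => ?_, fun x => (hfox x).1, fun x => (hfox x).2⟩, ?_⟩
  · change D.Dart at d
    change h (τ (τ (D.opp (τ.symm d)))) = h (τ d)
    rw [inv, hsymm, hedge]
  · rintro ⟨c, k1, k2⟩
    have k1' : ∀ d, h d = c := fun d => by rw [← inv d]; exact k1 (τ d)
    refine hn ⟨c, fun d => ?_, k2⟩
    -- The old inner colors are determined by the outer ones, so they equal `c` as well.
    have p1 : f (x₁, i₁ + 2) = c := by rw [← h12, k1']
    have p2 : f (x₂, i₂ + 2) = c := by rw [← h22, k1']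
    have q3 : f (x₁, i₁ + 3) = c := by rw [← h13, k1']
    have q1 : f (x₂, i₂ + 3) = c := by rw [← h23, k1']
    have m1 : f (x₁, i₁) = c := by rw [c₁, p1]
    have m2 : f (x₂, i₂) = c := by
      rw [c₂, p2, q1] at d₂; exact add_right_cancel d₂
    have m3 : f (x₁, i₁ + 1) = c := by
      rw [q3, m1, p1] at d₁; exact add_right_cancel d₁
    by_cases a1 : d = (x₁, i₁)
    · rw [a1, m1]
    by_cases a2 : d = (x₂, i₂ + 1)
    · rw [a2, e₁, m1]
    by_cases a3 : d = (x₂, i₂)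
    · rw [a3, m2]
    by_cases a4 : d = (x₃, i₃ + 1)
    · rw [a4, e₂, m2]
    by_cases a5 : d = (x₃, i₃)
    · rw [a5, ← e₃, m3]
    by_cases a6 : d = (x₁, i₁ + 1)
    · rw [a6, m3]
    rw [← hel d a1 a2 a3 a4 a5 a6, k1']

/-- The move produces a triangle again, with each corner turned by a half turn and the same `τ`; so
the move is its own inverse and one direction of invariance suffices. -/
theorem conj (T : D.Triangle x₁ x₂ x₃ i₁ i₂ i₃ τ) :
    (D.conj τ).Triangle x₁ x₂ x₃ (i₁ + 2) (i₂ + 2) (i₃ + 2) τ := by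
  have hsymm : ∀ d, τ.symm d = τ d := fun d => by rw [Equiv.symm_apply_eq, T.invol]
  have z1 : ∀ i : ZMod 4, i + 2 + 1 = i + 3 := by decide
  have z2 : ∀ i : ZMod 4, i + 2 + 2 = i := by decide
  have z3 : ∀ i : ZMod 4, i + 2 + 3 = i + 1 := by decide
  have ho : ∀ d, (D.conj τ).opp d = τ (D.opp (τ d)) := fun d => by
    rw [← hsymm d]; rfl
  have o₁ : D.opp (x₂, i₂ + 1) = (x₁, i₁) := by rw [← T.opp₁, D.opp_opp]
  have o₂ : D.opp (x₃, i₃ + 1) = (x₂, i₂) := by rw [← T.opp₂, D.opp_opp]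
  have o₃ : D.opp (x₁, i₁ + 1) = (x₃, i₃) := by rw [← T.opp₃, D.opp_opp]
  refine ⟨T.ne₁, T.ne₂, T.ne₃, ?_, ?_, ?_, ?_, ?_, ?_, ?_, ?_, ?_, ?_, ?_, T.fixed, T.invol⟩
  · rcases T.odd with h | h <;> rw [h] <;> decide
  · rcases T.even with h | h <;> rw [h] <;> decide
  · refine (ho _).trans ?_
    change τ (D.opp (τ (x₁, i₁ + 2))) = (⟨x₂, i₂ + 2 + 1⟩ : D.Dart)
    rw [T.outer₁, o₁, T.inner₁, z1]
  · refine (ho _).trans ?_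
    change τ (D.opp (τ (x₂, i₂ + 2))) = (⟨x₃, i₃ + 2 + 1⟩ : D.Dart)
    rw [T.outer₂, o₂, T.inner₂, z1]
  · refine (ho _).trans ?_
    change τ (D.opp (τ (x₃, i₃ + 2))) = (⟨x₁, i₁ + 2 + 1⟩ : D.Dart)
    rw [T.outer₃, o₃, T.inner₃, z1]
  · rw [z3]; exact T.outer₁
  · rw [z3]; exact T.outer₂
  · rw [z3]; exact T.outer₃
  · rw [z2, z1]; exact T.inner₁
  · rw [z2, z1]; exact T.inner₂
  · rw [z2, z1]; exact T.inner₃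

theorem hasNonconstantColoring_iff (T : D.Triangle x₁ x₂ x₃ i₁ i₂ i₃ τ) :
    D.HasNonconstantColoring A ↔ (D.conj τ).HasNonconstantColoring A := by
  refine ⟨T.hasNonconstantColoring_conj, fun h => ?_⟩
  have h2 := T.conj.hasNonconstantColoring_conj h
  have hsymm : ∀ d, τ.symm d = τ d := fun d => by rw [Equiv.symm_apply_eq, T.invol]
  have e : ((D.conj τ).conj τ).Iso D := by
    refine ⟨rfl, Equiv.refl _, fun _ => 0, fun _ => .inl rfl, fun d => ?_⟩
    change D.Dart at d
    have : τ (τ (D.opp (τ.symm (τ.symm d)))) = D.opp d := by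
      rw [T.invol, hsymm, hsymm, T.invol]
    change D.opp (d.1, d.2 + 0) = ((τ (τ (D.opp (τ.symm (τ.symm d))))).1,
      (τ (τ (D.opp (τ.symm (τ.symm d))))).2 + 0)
    rw [this, add_zero, add_zero]
  exact e.hasNonconstantColoring_iff.1 h2

end Triangle

end Invariance

theorem strandSwap_apply {D : PreDiagram} [DecidableEq D.Dart] {x y : D.Crossing} {i j : ZMod 4}
    (hxy : x ≠ y) (h : D.opp (x, i) = (y, j + 1)) (z : D.Dart) :
    D.strandSwap (x, i) z =
      if z = (x, i) then (y, j + 3) else if z = (x, i + 2) then (y, j + 1) else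
      if z = (y, j + 1) then (x, i + 2) else if z = (y, j + 3) then (x, i) else z := by
  have z0 : (2 : ZMod 4) ≠ 0 := by decide
  have z1 : (3 : ZMod 4) ≠ 1 := by decide
  have e : j + 1 + 2 = j + 3 := by ring
  have a1 : ((x, i) : D.Dart) ≠ (x, i + 2) := by simp [z0]
  have a2 : ((x, i) : D.Dart) ≠ (y, j + 1) := by simp [hxy]
  have a3 : ((x, i) : D.Dart) ≠ (y, j + 3) := by simp [hxy]
  have a4 : ((x, i + 2) : D.Dart) ≠ (y, j + 1) := by simp [hxy]
  have a5 : ((x, i + 2) : D.Dart) ≠ (y, j + 3) := by simp [hxy]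
  have a6 : ((y, j + 1) : D.Dart) ≠ (y, j + 3) := by simp [z1.symm]
  have hs : D.strandSwap (x, i) z = Equiv.swap (x, i + 2) (y, j + 1)
      (Equiv.swap (x, i) (y, j + 3) z) := by
    simp only [strandSwap, across, h, e, Equiv.Perm.mul_apply]
    congr!
  rw [hs]
  split_ifs with b1 b2 b3 b4
  · rw [b1, Equiv.swap_apply_left, Equiv.swap_apply_of_ne_of_ne a5.symm a6.symm]
  · rw [b2, Equiv.swap_apply_of_ne_of_ne a1.symm a5, Equiv.swap_apply_left]
  · rw [b3, Equiv.swap_apply_of_ne_of_ne a2.symm a6, Equiv.swap_apply_right]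
  · rw [b4, Equiv.swap_apply_right, Equiv.swap_apply_of_ne_of_ne a1 a2]
  · rw [Equiv.swap_apply_of_ne_of_ne b1 b4, Equiv.swap_apply_of_ne_of_ne b2 b3]

/-- The three strand swaps have disjoint supports, which together are the twelve darts at the
corners; so their product is an involution and can be evaluated dart by dart. -/
theorem triangle_strandSwap {D : PreDiagram} {x₁ x₂ x₃ : D.Crossing} {i₁ i₂ i₃ : ZMod 4}
    (n₁ : x₁ ≠ x₂) (n₂ : x₂ ≠ x₃) (n₃ : x₃ ≠ x₁) (odd : i₁ = 1 ∨ i₁ = 3)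
    (even : i₂ = 0 ∨ i₂ = 2) (o₁ : D.opp (x₁, i₁) = (x₂, i₂ + 1))
    (o₂ : D.opp (x₂, i₂) = (x₃, i₃ + 1)) (o₃ : D.opp (x₃, i₃) = (x₁, i₁ + 1)) :
    D.Triangle x₁ x₂ x₃ i₁ i₂ i₃
      (D.strandSwap (x₁, i₁) * D.strandSwap (x₂, i₂) * D.strandSwap (x₃, i₃)) := by
  classical
  set τ := D.strandSwap (x₁, i₁) * D.strandSwap (x₂, i₂) * D.strandSwap (x₃, i₃) with hτ
  have ht : ∀ z, τ z = D.strandSwap (x₁, i₁) (D.strandSwap (x₂, i₂) (D.strandSwap (x₃, i₃) z)) :=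
    fun _ => rfl
  have z1 : (1 : ZMod 4) ≠ 0 := by decide
  have z2 : (2 : ZMod 4) ≠ 0 := by decide
  have z3 : (3 : ZMod 4) ≠ 0 := by decide
  have z21 : (2 : ZMod 4) ≠ 1 := by decide
  have z31 : (3 : ZMod 4) ≠ 1 := by decide
  have z32 : (3 : ZMod 4) ≠ 2 := by decide
  have key : (τ (x₁, i₁) = (x₂, i₂ + 3) ∧ τ (x₂, i₂) = (x₃, i₃ + 3) ∧
      τ (x₃, i₃) = (x₁, i₁ + 3)) ∧ (τ (x₁, i₁ + 2) = (x₂, i₂ + 1) ∧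
      τ (x₂, i₂ + 2) = (x₃, i₃ + 1) ∧ τ (x₃, i₃ + 2) = (x₁, i₁ + 1)) ∧
      (τ (x₂, i₂ + 3) = (x₁, i₁) ∧ τ (x₃, i₃ + 3) = (x₂, i₂) ∧ τ (x₁, i₁ + 3) = (x₃, i₃)) ∧
      τ (x₂, i₂ + 1) = (x₁, i₁ + 2) ∧ τ (x₃, i₃ + 1) = (x₂, i₂ + 2) ∧
      τ (x₁, i₁ + 1) = (x₃, i₃ + 2) := by
    refine ⟨⟨?_, ?_, ?_⟩, ⟨?_, ?_, ?_⟩, ⟨?_, ?_, ?_⟩, ?_, ?_, ?_⟩ <;>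
    · rw [ht, strandSwap_apply n₃ o₃, strandSwap_apply n₂ o₂, strandSwap_apply n₁ o₁]
      simp [n₁, n₁.symm, n₂, n₂.symm, n₃, n₃.symm, z1, z2, z3, z21, z21.symm, z31,
        z32, z32.symm]
  obtain ⟨⟨s₁, s₂, s₃⟩, ⟨t₁, t₂, t₃⟩, ⟨s₁', s₂', s₃'⟩, t₁', t₂', t₃'⟩ := key
  have fix : ∀ d : D.Dart, d.1 ≠ x₁ → d.1 ≠ x₂ → d.1 ≠ x₃ → τ d = d := by
    rintro ⟨x, i⟩ a1 a2 a3
    simp only at a1 a2 a3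
    rw [ht, strandSwap_apply n₃ o₃, strandSwap_apply n₂ o₂, strandSwap_apply n₁ o₁]
    simp [a1, a2, a3]
  refine ⟨n₁, n₂, n₃, odd, even, o₁, o₂, o₃, s₁, s₂, s₃, t₁, t₂, t₃, fix, ?_⟩
  rintro ⟨x, i⟩
  by_cases a1 : x = x₁
  · rw [a1]
    rcases zmod_four_cases_add i₁ i with rfl | rfl | rfl | rfl
    exacts [by rw [s₁, s₁'], by rw [t₃', t₃], by rw [t₁, t₁'], by rw [s₃', s₃]]
  by_cases a2 : x = x₂
  · rw [a2]
    rcases zmod_four_cases_add i₂ i with rfl | rfl | rfl | rfl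
    exacts [by rw [s₂, s₂'], by rw [t₁', t₁], by rw [t₂, t₂'], by rw [s₁', s₁]]
  by_cases a3 : x = x₃
  · rw [a3]
    rcases zmod_four_cases_add i₃ i with rfl | rfl | rfl | rfl
    exacts [by rw [s₃, s₃'], by rw [t₂', t₂], by rw [t₃, t₃'], by rw [s₂', s₂]]
  rw [fix (x, i) a1 a2 a3, fix (x, i) a1 a2 a3]

variable {A : Type} [AddCommGroup A]

theorem R3.hasNonconstantColoring_iff {D E : PreDiagram} (h : D.R3 E) :
    D.HasNonconstantColoring A ↔ E.HasNonconstantColoring A := by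
  obtain ⟨⟨x₁, i₁⟩, ⟨x₂, i₂⟩, ⟨x₃, i₃⟩, f1, f2, f3, n₁, n₂, n₃, v1, v2, hi⟩ := h
  rw [← hi.hasNonconstantColoring_iff]
  have aux : ∀ d x i, D.faceNext d = (x, i) → D.opp d = (x, i + 1) := by
    rintro d x i h
    obtain ⟨h1, h2⟩ := Prod.mk.inj h
    exact Prod.ext h1 (by rw [← h2]; ring)
  have o₁ := aux _ _ _ f1
  -- The top strand reaches `x₂` at the dart `i₂ + 1`, which is odd; so the boundary dart `i₂` is on
  -- the lower strand.
  have even : i₂ = 0 ∨ i₂ = 2 := by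
    rw [o₁] at v2
    exact (by decide : ∀ i : ZMod 4, (i + 1 = 1 ∨ i + 1 = 3) → i = 0 ∨ i = 2) i₂ v2
  exact (triangle_strandSwap n₁ n₂ n₃ v1 even o₁ (aux _ _ _ f2)
    (aux _ _ _ f3)).hasNonconstantColoring_iff

/-! ### Invariance of the link type, and the unknot -/

theorem _root_.LinkDiagram.SameLink.hasNonconstantColoring_iff {D E : LinkDiagram}
    (h : D.SameLink E) : D.HasNonconstantColoring A ↔ E.HasNonconstantColoring A := by
  induction h with
  | rel D E h =>
    rcases h with h | h | h | h | h
    · exact Iso.hasNonconstantColoring_iff h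
    · exact R1.hasNonconstantColoring_iff h
    · exact R1Circle.hasNonconstantColoring_iff h
    · exact R2.hasNonconstantColoring_iff h
    · exact R3.hasNonconstantColoring_iff h
  | refl D => exact Iff.rfl
  | symm D E _ ih => exact ih.symm
  | trans D E F _ _ ih1 ih2 => exact ih1.trans ih2

/-- All colorings of a diagram of the unknot are constant. -/
theorem _root_.LinkDiagram.IsUnknot.not_hasNonconstantColoring {D : LinkDiagram}
    (h : D.IsUnknot) : ¬ D.HasNonconstantColoring A := by
  rw [LinkDiagram.SameLink.hasNonconstantColoring_iff (A := A) h]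
  rintro ⟨f, g, -, hn⟩
  change Fin 1 → A at g
  refine hn ⟨g 0, fun d => d.1.elim, fun i => ?_⟩
  change Fin 1 at i
  rw [Subsingleton.elim i 0]


/-! ### Upper and lower darts of alternating diagrams -/

variable {D : PreDiagram}

theorem not_isOver_iff {d : D.Dart} : ¬ IsOver d ↔ d.2 = 0 ∨ d.2 = 2 := by
  obtain ⟨x, i⟩ := d
  simp only [IsOver]
  revert i; decide

theorem sum_zmod_four {M : Type*} [AddCommMonoid M] (g : ZMod 4 → M) :
    ∑ i, g i = g 0 + g 1 + g 2 + g 3 := Fin.sum_univ_four g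

theorem sum_opp {M : Type*} [AddCommMonoid M] (F : D.Dart → M) :
    ∑ d, F (D.opp d) = ∑ d, F d :=
  Equiv.sum_comp (Function.Involutive.toPerm D.opp D.opp_opp) F

theorem isOver_one (x : D.Crossing) : IsOver (D := D) (x, 1) := .inl rfl

theorem isOver_three (x : D.Crossing) : IsOver (D := D) (x, 3) := .inr rfl

theorem not_isOver_zero (x : D.Crossing) : ¬ IsOver (D := D) (x, 0) :=
  not_isOver_iff.2 (.inl rfl)

theorem not_isOver_two (x : D.Crossing) : ¬ IsOver (D := D) (x, 2) :=
  not_isOver_iff.2 (.inr rfl)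

/-- In an alternating diagram, `opp` exchanges the upper and the lower darts. -/
theorem Alternating.sum_upper {M : Type*} [AddCommMonoid M] (hA : D.Alternating)
    (F : D.Dart → M) :
    ∑ x, (F (x, 1) + F (x, 3)) = ∑ x, (F (D.opp (x, 0)) + F (D.opp (x, 2))) := by
  classical
  have h1 : ∑ d, (if IsOver d then F d else 0) = ∑ x, (F (x, 1) + F (x, 3)) := by
    rw [Fintype.sum_prod_type]
    refine Finset.sum_congr rfl fun x _ => ?_
    rw [sum_zmod_four, if_neg (not_isOver_zero x), if_pos (isOver_one x),
      if_neg (not_isOver_two x), if_pos (isOver_three x)]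
    simp only [zero_add, add_zero]
  have h2 : ∑ d, (if IsOver (D := D) d then 0 else F (D.opp d)) =
      ∑ x, (F (D.opp (x, 0)) + F (D.opp (x, 2))) := by
    rw [Fintype.sum_prod_type]
    refine Finset.sum_congr rfl fun x _ => ?_
    rw [sum_zmod_four, if_neg (not_isOver_zero x), if_pos (isOver_one x),
      if_neg (not_isOver_two x), if_pos (isOver_three x)]
    simp only [add_zero]
  rw [← h1, ← h2, ← sum_opp]
  refine Finset.sum_congr rfl fun d _ => ?_
  by_cases h : IsOver d
  · rw [if_neg (fun h' => (hA d).1 h' h), if_pos h]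
  · rw [if_pos ((hA d).2 h), if_neg h]

/-! ### The flow through a set of crossings -/

open Classical in
/-- The upper darts at crossings in `S` whose edges leave `S`. -/
noncomputable def outDarts (D : PreDiagram) (S : Set D.Crossing) : Finset D.Dart :=
  Finset.univ.filter fun d => IsOver d ∧ d.1 ∈ S ∧ (D.opp d).1 ∉ S

open Classical in
/-- The lower darts at crossings in `S` whose edges leave `S`. -/
noncomputable def inDarts (D : PreDiagram) (S : Set D.Crossing) : Finset D.Dart :=
  Finset.univ.filter fun d => ¬ IsOver d ∧ d.1 ∈ S ∧ (D.opp d).1 ∉ S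

theorem mem_outDarts {S : Set D.Crossing} {d : D.Dart} :
    d ∈ D.outDarts S ↔ IsOver d ∧ d.1 ∈ S ∧ (D.opp d).1 ∉ S := by simp [outDarts]

theorem mem_inDarts {S : Set D.Crossing} {d : D.Dart} :
    d ∈ D.inDarts S ↔ ¬ IsOver d ∧ d.1 ∈ S ∧ (D.opp d).1 ∉ S := by simp [inDarts]

/-- Conservation of flow: with edges directed from upper to lower end, every crossing has two
outgoing and two incoming edges, and edges inside `S` cancel. -/
theorem Alternating.card_inDarts (hA : D.Alternating) (S : Set D.Crossing) :
    (D.inDarts S).card = (D.outDarts S).card := by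
  classical
  have e1 : (D.outDarts S).card + (Finset.univ.filter fun d : D.Dart =>
      IsOver d ∧ d.1 ∈ S ∧ (D.opp d).1 ∈ S).card =
      (Finset.univ.filter fun d : D.Dart => IsOver d ∧ d.1 ∈ S).card := by
    rw [outDarts, ← Finset.card_union_of_disjoint, ← Finset.filter_or]
    · congr 1; ext d; simp only [Finset.mem_filter, Finset.mem_univ]; tauto
    · rw [Finset.disjoint_filter]; tauto
  have e2 : (D.inDarts S).card + (Finset.univ.filter fun d : D.Dart =>
      ¬ IsOver d ∧ d.1 ∈ S ∧ (D.opp d).1 ∈ S).card =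
      (Finset.univ.filter fun d : D.Dart => ¬ IsOver d ∧ d.1 ∈ S).card := by
    rw [inDarts, ← Finset.card_union_of_disjoint, ← Finset.filter_or]
    · congr 1; ext d; simp only [Finset.mem_filter, Finset.mem_univ]; tauto
    · rw [Finset.disjoint_filter]; tauto
  have e3 : (Finset.univ.filter fun d : D.Dart => IsOver d ∧ d.1 ∈ S ∧ (D.opp d).1 ∈ S).card =
      (Finset.univ.filter fun d : D.Dart => ¬ IsOver d ∧ d.1 ∈ S ∧ (D.opp d).1 ∈ S).card := by
    refine Finset.card_nbij' D.opp D.opp ?_ ?_ (fun d _ => D.opp_opp d) (fun d _ => D.opp_opp d)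
    · intro d hd
      simp only [Finset.coe_filter, Finset.mem_univ, true_and, Set.mem_ofPred_eq] at hd ⊢
      rw [D.opp_opp]
      exact ⟨fun h => (hA d).1 h hd.1, hd.2.2, hd.2.1⟩
    · intro d hd
      simp only [Finset.coe_filter, Finset.mem_univ, true_and, Set.mem_ofPred_eq] at hd ⊢
      rw [D.opp_opp]
      exact ⟨(hA d).2 hd.1, hd.2.2, hd.2.1⟩
  -- A quarter turn at each crossing matches upper with lower darts.
  have e4 : (Finset.univ.filter fun d : D.Dart => IsOver d ∧ d.1 ∈ S).card =
      (Finset.univ.filter fun d : D.Dart => ¬ IsOver d ∧ d.1 ∈ S).card := by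
    refine Finset.card_nbij' (fun d => (d.1, d.2 + 1)) (fun d => (d.1, d.2 - 1)) ?_ ?_
      (fun d _ => by simp) (fun d _ => by simp)
    · rintro ⟨x, i⟩ hd
      simp only [Finset.coe_filter, Finset.mem_univ, true_and, Set.mem_ofPred_eq] at hd ⊢
      exact ⟨not_isOver_iff.2 ((by decide : ∀ i : ZMod 4, i = 1 ∨ i = 3 → i + 1 = 0 ∨ i + 1 = 2)
        i hd.1), hd.2⟩
    · rintro ⟨x, i⟩ hd
      simp only [Finset.coe_filter, Finset.mem_univ, true_and, Set.mem_ofPred_eq] at hd ⊢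
      exact ⟨(by decide : ∀ i : ZMod 4, i = 0 ∨ i = 2 → i - 1 = 1 ∨ i - 1 = 3) i
        (not_isOver_iff.1 hd.1), hd.2⟩
  omega

theorem Alternating.card_outDarts_compl (hA : D.Alternating) (S : Set D.Crossing) :
    (D.outDarts Sᶜ).card = (D.outDarts S).card := by
  rw [← hA.card_inDarts S]
  refine Finset.card_nbij' D.opp D.opp ?_ ?_ (fun d _ => D.opp_opp d) (fun d _ => D.opp_opp d)
  · intro d hd
    rw [Finset.mem_coe, mem_outDarts] at hd
    rw [Finset.mem_coe, mem_inDarts, D.opp_opp]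
    simp only [Set.mem_compl_iff, not_not] at hd
    exact ⟨fun h => (hA d).1 h hd.1, hd.2.2, hd.2.1⟩
  · intro d hd
    rw [Finset.mem_coe, mem_inDarts] at hd
    rw [Finset.mem_coe, mem_outDarts, D.opp_opp]
    simp only [Set.mem_compl_iff, not_not]
    exact ⟨(hA d).2 hd.1, hd.2.2, hd.2.1⟩

/-- Submodularity of the directed cut function, which holds edge by edge. -/
theorem card_outDarts_inter_add_union (S T : Set D.Crossing) :
    (D.outDarts (S ∩ T)).card + (D.outDarts (S ∪ T)).card ≤
      (D.outDarts S).card + (D.outDarts T).card := by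
  classical
  simp only [outDarts, Finset.card_filter, ← Finset.sum_add_distrib]
  refine Finset.sum_le_sum fun d _ => ?_
  simp only [Set.mem_inter_iff, Set.mem_union]
  by_cases h1 : d.1 ∈ S <;> by_cases h2 : d.1 ∈ T <;> by_cases h3 : (D.opp d).1 ∈ S <;>
    by_cases h4 : (D.opp d).1 ∈ T <;> by_cases h5 : IsOver d <;> simp [h1, h2, h3, h4, h5]

theorem eq_univ_of_closed [Subsingleton D.Component] {S : Set D.Crossing} (hS : S.Nonempty)
    (h : ∀ d : D.Dart, d.1 ∈ S → (D.opp d).1 ∈ S) : S = Set.univ := by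
  obtain ⟨x, hx⟩ := hS
  have key : ∀ x y : D.Crossing, (∃ i : ZMod 4, (D.opp (x, i)).1 = y) → (x ∈ S) = (y ∈ S) := by
    rintro x y ⟨i, rfl⟩
    refine propext ⟨h (x, i), fun hy => ?_⟩
    have := h _ hy
    rwa [D.opp_opp] at this
  refine Set.eq_univ_of_forall fun y => ?_
  have e := Subsingleton.elim (α := D.Component) (Quot.mk _ x) (Quot.mk _ y)
  have := congrArg (Quot.lift (fun x => x ∈ S) key) e
  exact this.mp hx

/-- With no outgoing edge there is no incoming one either, so `S` would be a union of components. -/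
theorem Alternating.outDarts_card_pos (hA : D.Alternating) [Subsingleton D.Component]
    {S : Set D.Crossing} (hS : S.Nonempty) (hS' : S ≠ Set.univ) : 0 < (D.outDarts S).card := by
  by_contra h0
  have h1 : D.outDarts S = ∅ := Finset.card_eq_zero.1 (by omega)
  have h2 : D.inDarts S = ∅ := Finset.card_eq_zero.1 (by rw [hA.card_inDarts]; omega)
  refine hS' (eq_univ_of_closed hS fun d hd => ?_)
  by_contra hd'
  by_cases ho : IsOver d
  · have : d ∈ D.outDarts S := mem_outDarts.2 ⟨ho, hd, hd'⟩
    rw [h1] at this; simp at this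
  · have : d ∈ D.inDarts S := mem_inDarts.2 ⟨ho, hd, hd'⟩
    rw [h2] at this; simp at this

theorem upper_cases {d : D.Dart} (h : IsOver d) : d = (d.1, 1) ∨ d = (d.1, 3) :=
  h.imp (fun h => Prod.ext rfl h) (fun h => Prod.ext rfl h)

theorem lower_cases {d : D.Dart} (h : ¬ IsOver d) : d = (d.1, 0) ∨ d = (d.1, 2) :=
  (not_isOver_iff.1 h).imp (fun h => Prod.ext rfl h) (fun h => Prod.ext rfl h)

/-- The maximum principle, for a function with one source `x` and one sink `y`: the set where the
maximum is attained has a single outgoing edge. -/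
theorem Alternating.exists_cut (hA : D.Alternating) [Subsingleton D.Component]
    {x y : D.Crossing} (m : D.Crossing → ℤ) (hx : 2 * m x - m (D.opp (x, 1)).1
      - m (D.opp (x, 3)).1 = 1) (hy : 2 * m y - m (D.opp (y, 1)).1 - m (D.opp (y, 3)).1 = -1)
    (hm : ∀ c, c ≠ x → c ≠ y → 2 * m c - m (D.opp (c, 1)).1 - m (D.opp (c, 3)).1 = 0) :
    ∃ S : Set D.Crossing, x ∈ S ∧ y ∉ S ∧ (D.outDarts S).card = 1 := by
  obtain ⟨z, -, hz⟩ := Finset.exists_max_image (Finset.univ : Finset D.Crossing) m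
    ⟨x, Finset.mem_univ x⟩
  have hz' : ∀ c, m c ≤ m z := fun c => hz c (Finset.mem_univ c)
  let S : Set D.Crossing := {c | m c = m z}
  have hzS : z ∈ S := rfl
  -- At the sink some out-neighbour has a larger value.
  have hyS : y ∉ S := fun h => by
    have h : m y = m z := h
    have := hz' (D.opp (y, 1)).1
    have := hz' (D.opp (y, 3)).1
    omega
  -- Elsewhere a maximal value is the mean of those at the two out-neighbours, so these are maximal
  -- too; only `x` can emit edges out of `S`.
  have hcS : ∀ c ∈ S, c ≠ x → (D.opp (c, 1)).1 ∈ S ∧ (D.opp (c, 3)).1 ∈ S := by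
    intro c hc hcx
    have h0 := hm c hcx (fun h => hyS (h ▸ hc))
    have h1 := hz' (D.opp (c, 1)).1
    have h2 := hz' (D.opp (c, 3)).1
    have h3 : m c = m z := hc
    exact ⟨show _ = _ by omega, show _ = _ by omega⟩
  have hS : S ≠ Set.univ := fun h => hyS (h ▸ Set.mem_univ y)
  have hpos := hA.outDarts_card_pos ⟨z, hzS⟩ hS
  have hout : ∀ d ∈ D.outDarts S, d.1 = x := by
    intro d hd
    obtain ⟨h1, h2, h3⟩ := mem_outDarts.1 hd
    by_contra hne
    obtain ⟨h4, h5⟩ := hcS d.1 h2 hne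
    rcases upper_cases h1 with h | h
    · rw [h] at h3; exact h3 h4
    · rw [h] at h3; exact h3 h5
  have hle : (D.outDarts S).card ≤ 1 := by
    -- Values are integers, so if both out-neighbours of `x` were below the maximum, the source
    -- would have strength at least `2`.
    have hnot : x ∈ S → ¬ ((D.opp (x, 1)).1 ∉ S ∧ (D.opp (x, 3)).1 ∉ S) := by
      rintro hxS ⟨h1, h2⟩
      have h1' : m (D.opp (x, 1)).1 ≠ m z := h1
      have h2' : m (D.opp (x, 3)).1 ≠ m z := h2
      have h3 : m x = m z := hxS
      have := hz' (D.opp (x, 1)).1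
      have := hz' (D.opp (x, 3)).1
      omega
    rw [Finset.card_le_one]
    intro a ha b hb
    have ea := hout a ha
    have eb := hout b hb
    obtain ⟨a1, a2, a3⟩ := mem_outDarts.1 ha
    obtain ⟨b1, b2, b3⟩ := mem_outDarts.1 hb
    rcases upper_cases a1 with h | h <;> rcases upper_cases b1 with h' | h' <;>
      rw [ea] at h a2 <;> rw [eb] at h' <;> rw [h] at a3 <;> rw [h'] at b3 <;> rw [h, h']
    · exact absurd ⟨a3, b3⟩ (hnot a2)
    · exact absurd ⟨b3, a3⟩ (hnot a2)
  refine ⟨S, ?_, hyS, by omega⟩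
  obtain ⟨d, hd⟩ := Finset.card_pos.1 hpos
  rw [← hout d hd]
  exact (mem_outDarts.1 hd).2.1

/-- The maximum principle for integral colorings. -/
theorem Alternating.eq_of_fox (hA : D.Alternating) [Subsingleton D.Component]
    (g : D.Crossing → ℤ)
    (hg : ∀ c, 2 * g c - g (D.opp (c, 0)).1 - g (D.opp (c, 2)).1 = 0) (x y : D.Crossing) :
    g x = g y := by
  obtain ⟨z, -, hz⟩ := Finset.exists_max_image (Finset.univ : Finset D.Crossing) g
    ⟨x, Finset.mem_univ x⟩
  have hz' : ∀ c, g c ≤ g z := fun c => hz c (Finset.mem_univ c)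
  let S : Set D.Crossing := {c | g c = g z}
  suffices hS : S = Set.univ by
    have hx : x ∈ S := hS ▸ Set.mem_univ x
    have hy : y ∈ S := hS ▸ Set.mem_univ y
    exact Eq.trans hx (Eq.symm hy)
  by_contra hS
  have hpos := hA.outDarts_card_pos ⟨z, show z ∈ S from rfl⟩ hS
  -- Here values are averaged along incoming edges, so the contradiction comes from an edge entering
  -- the maximum set.
  rw [← hA.card_inDarts] at hpos
  obtain ⟨d, hd⟩ := Finset.card_pos.1 hpos
  obtain ⟨h1, h2, h3⟩ := mem_inDarts.1 hd
  have h2' : g d.1 = g z := h2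
  have h3' : g (D.opp d).1 ≠ g z := h3
  have e := hg d.1
  have e0 := hz' (D.opp (d.1, 0)).1
  have e2 := hz' (D.opp (d.1, 2)).1
  rcases lower_cases h1 with h | h <;> rw [h] at h3' <;> omega

/-! ### Arcs of alternating diagrams -/

open Classical in
/-- The crossing at which the edge of a dart passes over. -/
noncomputable def upperCrossing (D : PreDiagram) (d : D.Dart) : D.Crossing :=
  if IsOver d then d.1 else (D.opp d).1

/-- The crossing at which an arc of an alternating diagram passes over. -/
noncomputable def Alternating.arcCrossing (hA : D.Alternating) (hc : D.circles = 0) :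
    D.Arc → D.Crossing
  | Sum.inl a => Quot.lift D.upperCrossing (by
      intro d e h
      rcases h with _ | x
      · by_cases h : IsOver d
        · rw [upperCrossing, upperCrossing, if_pos h, if_neg (fun h' => (hA d).1 h' h), D.opp_opp]
        · rw [upperCrossing, upperCrossing, if_neg h, if_pos ((hA d).2 h)]
      · rw [upperCrossing, upperCrossing, if_pos (isOver_one x),
          if_pos (isOver_three x)]) a
  | Sum.inr i => (Fin.cast hc i).elim0

theorem arc_opp (d : D.Dart) : D.arc (D.opp d) = D.arc d :=
  congrArg Sum.inl (Quot.sound (ArcStep.edge d)).symm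

theorem arc_three (x : D.Crossing) : D.arc (x, 3) = D.arc (x, 1) :=
  congrArg Sum.inl (Quot.sound (ArcStep.over x)).symm

theorem Alternating.arc_upperCrossing (hA : D.Alternating) (d : D.Dart) :
    D.arc (D.upperCrossing d, 1) = D.arc d := by
  have key : ∀ d : D.Dart, IsOver d → D.arc (d.1, 1) = D.arc d := by
    intro d h
    rcases upper_cases h with h | h
    · exact congrArg D.arc h.symm
    · exact (arc_three d.1).symm.trans (congrArg D.arc h.symm)
  by_cases h : IsOver d
  · rw [upperCrossing, if_pos h, key d h]
  · rw [upperCrossing, if_neg h, key _ ((hA d).2 h), arc_opp]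

/-- With `upperCrossing_of_isOver` this identifies arcs with crossings, which turns colorings into
functions on crossings. -/
theorem Alternating.arc_arcCrossing (hA : D.Alternating) (hc : D.circles = 0) (a : D.Arc) :
    D.arc (hA.arcCrossing hc a, 1) = a := by
  obtain ⟨⟨d⟩⟩ | i := a
  · exact hA.arc_upperCrossing d
  · exact (Fin.cast hc i).elim0

theorem upperCrossing_of_isOver {d : D.Dart} (h : IsOver d) : D.upperCrossing d = d.1 := if_pos h

theorem upperCrossing_of_not_isOver {d : D.Dart} (h : ¬ IsOver d) :
    D.upperCrossing d = (D.opp d).1 := if_neg h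

/-- Two arcs which are equal in `Col(D)` are separated by a set of crossings with a single outgoing
edge. -/
theorem Alternating.exists_cut_of_colArc_eq (hA : D.Alternating) (hc : D.circles = 0)
    [Subsingleton D.Component] {x y : D.Crossing} (hxy : x ≠ y)
    (h : D.colArc (D.arc (x, 1)) = D.colArc (D.arc (y, 1))) :
    ∃ S : Set D.Crossing, x ∈ S ∧ y ∉ S ∧ (D.outDarts S).card = 1 := by
  classical
  have hmem : FreeAbelianGroup.of (D.arc (x, 1)) - FreeAbelianGroup.of (D.arc (y, 1)) ∈
      D.colRelations := (QuotientAddGroup.eq_iff_sub_mem).1 h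
  -- Elements of the free group are tested against all integral functions `w` on the arcs, regarded
  -- as functions on crossings.
  let L : (D.Crossing → ℤ) → FreeAbelianGroup D.Arc →+ ℤ := fun w =>
    FreeAbelianGroup.lift fun a => w (hA.arcCrossing hc a)
  have hL : ∀ w d, L w (FreeAbelianGroup.of (D.arc d)) = w (D.upperCrossing d) := fun w d => by
    simp only [L, FreeAbelianGroup.lift_apply_of]
    rfl
  have key : ∀ v ∈ D.colRelations, ∃ m : D.Crossing → ℤ, ∀ w, L w v =
      ∑ c, m c * (2 * w c - w (D.opp (c, 0)).1 - w (D.opp (c, 2)).1) := by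
    intro v hv
    induction hv using AddSubgroup.closure_induction with
    | mem v hv =>
      obtain ⟨c, rfl⟩ := hv
      refine ⟨Pi.single c 1, fun w => ?_⟩
      rw [Finset.sum_eq_single c]
      · simp only [map_sub, map_nsmul, hL, upperCrossing_of_isOver (isOver_one c),
          upperCrossing_of_not_isOver (not_isOver_zero c),
          upperCrossing_of_not_isOver (not_isOver_two c), Pi.single_eq_same]
        simp
      · intro b _ hb
        rw [Pi.single_eq_of_ne hb, zero_mul]
      · exact fun h => absurd (Finset.mem_univ c) h
    | zero => exact ⟨0, fun w => by simp⟩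
    | add a b _ _ ha hb =>
      obtain ⟨m, hm⟩ := ha
      obtain ⟨k, hk⟩ := hb
      refine ⟨m + k, fun w => ?_⟩
      rw [map_add, hm, hk, ← Finset.sum_add_distrib]
      refine Finset.sum_congr rfl fun c _ => ?_
      rw [Pi.add_apply]; ring
    | neg a _ ha =>
      obtain ⟨m, hm⟩ := ha
      refine ⟨-m, fun w => ?_⟩
      rw [map_neg, hm, ← Finset.sum_neg_distrib]
      refine Finset.sum_congr rfl fun c _ => ?_
      rw [Pi.neg_apply]; ring
  obtain ⟨m, hm⟩ := key _ hmem
  -- Transposing the relation matrix replaces in-neighbours by out-neighbours, by counting each edge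
  -- at its other end.
  have dual : ∀ w : D.Crossing → ℤ, w x - w y =
      ∑ c, w c * (2 * m c - m (D.opp (c, 1)).1 - m (D.opp (c, 3)).1) := by
    intro w
    have e1 := hm w
    rw [map_sub, hL, hL, upperCrossing_of_isOver (isOver_one x),
      upperCrossing_of_isOver (isOver_one y)] at e1
    have e2 := hA.sum_upper fun d => m (D.opp d).1 * w d.1
    simp only [D.opp_opp] at e2
    have e3 : ∑ c, m c * (2 * w c - w (D.opp (c, 0)).1 - w (D.opp (c, 2)).1) =
        ∑ c, 2 * m c * w c - ∑ c, (m c * w (D.opp (c, 0)).1 + m c * w (D.opp (c, 2)).1) := by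
      rw [← Finset.sum_sub_distrib]
      exact Finset.sum_congr rfl fun c _ => by ring
    have e4 : ∑ c, w c * (2 * m c - m (D.opp (c, 1)).1 - m (D.opp (c, 3)).1) =
        ∑ c, 2 * m c * w c - ∑ c, (m (D.opp (c, 1)).1 * w c + m (D.opp (c, 3)).1 * w c) := by
      rw [← Finset.sum_sub_distrib]
      exact Finset.sum_congr rfl fun c _ => by ring
    rw [e1, e3, e4, e2]
  have at_point : ∀ c, 2 * m c - m (D.opp (c, 1)).1 - m (D.opp (c, 3)).1 =
      (if x = c then 1 else 0) - (if y = c then 1 else 0) := by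
    intro c
    have := dual (fun z => if z = c then 1 else 0)
    simpa using this.symm
  refine hA.exists_cut m ?_ ?_ fun c h1 h2 => ?_
  · rw [at_point, if_pos rfl, if_neg hxy.symm]; rfl
  · rw [at_point, if_pos rfl, if_neg hxy]; rfl
  · rw [at_point, if_neg h1.symm, if_neg h2.symm]; rfl


/-! ### Nonconstant colorings of reduced alternating diagrams -/

theorem face_faceNext (d : D.Dart) : D.face (D.faceNext d) = D.face d :=
  (Quot.sound (r := fun d e : D.Dart => e = D.faceNext d) rfl).symm

/-- By alternation a loop joins two neighbouring darts of its crossing; the face along its outer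
side then fills two opposite corners, so the crossing is nugatory. -/
theorem Reduced.opp_fst_ne (hR : D.Reduced) (hA : D.Alternating) {d : D.Dart} (hd : IsOver d) :
    (D.opp d).1 ≠ d.1 := by
  intro h
  have hodd : ¬ IsOver (D := D) (D.opp d) := fun h' => (hA d).1 h' hd
  obtain ⟨x, i⟩ := d
  have key : ∀ j k : ZMod 4, D.opp (x, j) = (x, k) → D.face (x, j) = D.face (x, k - 1) :=
    fun j k e => by rw [← face_faceNext, faceNext, e]
  have key' : ∀ j k : ZMod 4, D.opp (x, j) = (x, k) → D.opp (x, k) = (x, j) :=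
    fun j k e => by rw [← e, D.opp_opp]
  have e10 : (1 : ZMod 4) - 1 = 0 := by decide
  have e21 : (2 : ZMod 4) - 1 = 1 := by decide
  have e32 : (3 : ZMod 4) - 1 = 2 := by decide
  have e03 : (0 : ZMod 4) - 1 = 3 := by decide
  have hk : ∃ k, D.opp (x, i) = (x, k) ∧ (k = 0 ∨ k = 2) :=
    ⟨(D.opp (x, i)).2, Prod.ext h rfl, not_isOver_iff.1 hodd⟩
  obtain ⟨k, hk, hk'⟩ := hk
  simp only [IsOver] at hd
  apply hR x
  rcases hd with rfl | rfl <;> rcases hk' with rfl | rfl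
  · right
    rw [key _ _ hk, e03]
  · left
    rw [key _ _ (key' _ _ hk), e10]
  · left
    rw [key _ _ (key' _ _ hk), e32]
  · right
    rw [key _ _ hk, e21]

theorem isDartColoring_colArc (D : PreDiagram) :
    D.IsDartColoring fun d => D.colArc (D.arc d) := by
  refine ⟨fun d => by rw [arc_opp], fun x => by rw [arc_three], fun x => ?_⟩
  rw [arc_three, colArc, colArc, colArc, ← QuotientAddGroup.mk_add, ← QuotientAddGroup.mk_add,
    eq_comm, QuotientAddGroup.eq_iff_sub_mem]
  have := AddSubgroup.subset_closure (Set.mem_range_self (f := fun x : D.Crossing =>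
    2 • FreeAbelianGroup.of (D.arc (x, 1)) - FreeAbelianGroup.of (D.arc (x, 0))
      - FreeAbelianGroup.of (D.arc (x, 2))) x)
  rw [two_nsmul, sub_sub] at this
  exact this

/-- In a connected reduced alternating diagram, the arcs are not all equal in `Col(D)`. -/
theorem Reduced.hasNonconstantColoring_col (hR : D.Reduced) (hA : D.Alternating)
    (hc : D.circles = 0) [Subsingleton D.Component] [Nonempty D.Crossing] :
    D.HasNonconstantColoring D.Col := by
  refine ⟨fun d => D.colArc (D.arc d), fun _ => 0, D.isDartColoring_colArc, ?_⟩
  rintro ⟨c, hcol, -⟩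
  have cut : ∀ x y : D.Crossing, x ≠ y →
      ∃ S : Set D.Crossing, x ∈ S ∧ y ∉ S ∧ (D.outDarts S).card = 1 := fun x y hxy =>
    hA.exists_cut_of_colArc_eq hc hxy ((hcol (x, 1)).trans (hcol (y, 1)).symm)
  -- Descent on the size of a nonempty set with one outgoing edge.
  have none : ∀ n, ∀ S : Set D.Crossing, S.ncard = n → S.Nonempty →
      (D.outDarts S).card ≠ 1 := by
    intro n
    induction n using Nat.strong_induction_on with
    | _ n ih =>
      rintro S hn ⟨x, hx⟩ h1
      by_cases hs : ∃ y ∈ S, x ≠ y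
      · obtain ⟨y, hy, hxy⟩ := hs
        obtain ⟨T, hxT, hyT, hT⟩ := cut x y hxy
        -- If `S` and `T` cover everything, the complement of `T` is a smaller such set. Otherwise
        -- `S ∩ T` and `S ∪ T` each have an outgoing edge, and submodularity leaves exactly one for
        -- `S ∩ T`.
        by_cases hu : S ∪ T = Set.univ
        · have hss : Tᶜ ⊂ S := by
            refine ⟨fun z hz => ?_, fun h => h hx hxT⟩
            exact (hu ▸ Set.mem_univ z : z ∈ S ∪ T).resolve_right hz
          refine ih _ (hn ▸ Set.ncard_lt_ncard hss) Tᶜ rfl ⟨y, hyT⟩ ?_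
          rw [hA.card_outDarts_compl, hT]
        · have hss : S ∩ T ⊂ S := ⟨Set.inter_subset_left, fun h => hyT (h hy).2⟩
          refine ih _ (hn ▸ Set.ncard_lt_ncard hss) (S ∩ T) rfl ⟨x, hx, hxT⟩ ?_
          have p1 := hA.outDarts_card_pos (S := S ∩ T) ⟨x, hx, hxT⟩
            (fun h => hyT (h ▸ Set.mem_univ y : y ∈ S ∩ T).2)
          have p2 := hA.outDarts_card_pos (S := S ∪ T) ⟨x, .inl hx⟩ hu
          have p3 := card_outDarts_inter_add_union S T
          omega
      -- Now `S` is the single crossing `x`; without loops both of its upper edges leave it.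
      · have hne : ∀ d : D.Dart, IsOver d → d.1 = x → d ∈ D.outDarts S := by
          intro d hd hdx
          refine mem_outDarts.2 ⟨hd, hdx ▸ hx, fun h => hs ⟨_, h, ?_⟩⟩
          rw [← hdx]
          exact (hR.opp_fst_ne hA hd).symm
        obtain ⟨d, hd⟩ := Finset.card_eq_one.1 h1
        have e1 := hne _ (isOver_one x) rfl
        have e3 := hne _ (isOver_three x) rfl
        rw [hd, Finset.mem_singleton] at e1 e3
        have := congrArg Prod.snd (e1.trans e3.symm)
        exact (by decide : (1 : ZMod 4) ≠ 3) this
  obtain ⟨x⟩ := ‹Nonempty D.Crossing›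
  obtain ⟨S, hx, -, hS⟩ := cut x _ (hR.opp_fst_ne hA (isOver_one x)).symm
  exact none _ S rfl ⟨x, hx⟩ hS

/-! ### Euler's inequality -/

instance : Finite D.Face := inferInstanceAs (Finite (Quot _))

instance : Finite D.Component := inferInstanceAs (Finite (Quot _))

/-- The connected component of a crossing. -/
def component (D : PreDiagram) (x : D.Crossing) : D.Component := Quot.mk _ x

/-- The connected component of a face. -/
def faceComponent (D : PreDiagram) : D.Face → D.Component :=
  Quot.lift (fun d => D.component d.1) (by
    rintro d e rfl
    exact Quot.sound ⟨d.2, rfl⟩)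

/-- The difference of a function on the faces across the edge of a dart. -/
def faceDiff (D : PreDiagram) (g : D.Face → ℚ) (d : D.Dart) : ℚ :=
  g (D.face d) - g (D.face (d.1, d.2 - 1))

theorem faceDiff_opp (g : D.Face → ℚ) (d : D.Dart) :
    D.faceDiff g (D.opp d) = - D.faceDiff g d := by
  have h1 : D.face ((D.opp d).1, (D.opp d).2 - 1) = D.face d := face_faceNext d
  have h2 : D.face (d.1, d.2 - 1) = D.face (D.opp d) := by
    have := face_faceNext (D.opp d)
    rwa [faceNext, D.opp_opp] at this
  rw [faceDiff, faceDiff, h1, h2, neg_sub]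

/-- The upper dart with the given index. -/
def upperDart (D : PreDiagram) (o : D.Crossing × Bool) : D.Dart := (o.1, if o.2 then 1 else 3)

/-- The differences of a function on the crossings along the edges. -/
def crossingCoboundary (D : PreDiagram) : (D.Crossing → ℚ) →ₗ[ℚ] (D.Crossing × Bool → ℚ) where
  toFun f o := f (D.opp (D.upperDart o)).1 - f o.1
  map_add' f g := by ext o; simp; ring
  map_smul' c f := by ext o; simp; ring

/-- The differences of a function on the faces across the edges. -/
def faceCoboundary (D : PreDiagram) : (D.Face → ℚ) →ₗ[ℚ] (D.Crossing × Bool → ℚ) where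
  toFun g o := D.faceDiff g (D.upperDart o)
  map_add' f g := by ext o; simp [faceDiff]; ring
  map_smul' c f := by ext o; simp [faceDiff]; ring

theorem exists_component_factor {X : Type} (f : D.Crossing → X)
    (hf : ∀ d : D.Dart, f (D.opp d).1 = f d.1) :
    ∃ h : D.Component → X, ∀ x, h (D.component x) = f x :=
  ⟨Quot.lift f (by rintro x y ⟨i, rfl⟩; exact (hf (x, i)).symm), fun _ => rfl⟩

theorem Alternating.forall_dart (hA : D.Alternating) {P : D.Dart → Prop}
    (h1 : ∀ o, P (D.upperDart o)) (h2 : ∀ d, P (D.opp d) → P d) (d : D.Dart) : P d := by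
  have key : ∀ d, IsOver d → P d := by
    intro d hd
    rcases upper_cases hd with h | h
    · rw [h]; exact h1 (d.1, true)
    · rw [h]; exact h1 (d.1, false)
  by_cases h : IsOver d
  · exact key d h
  · exact h2 d (key _ ((hA d).2 h))

/-- Collecting the terms with `f x` leaves the sum of the face differences across the four edges at
`x`, which telescopes around the crossing. -/
theorem Alternating.coboundary_orthogonal (hA : D.Alternating) (f : D.Crossing → ℚ)
    (g : D.Face → ℚ) :
    ∑ o, D.crossingCoboundary f o * D.faceCoboundary g o = 0 := by
  let B := D.faceDiff g
  have e1 : ∑ o, D.crossingCoboundary f o * D.faceCoboundary g o =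
      ∑ x, (f (D.opp (x, 1)).1 * B (x, 1) + f (D.opp (x, 3)).1 * B (x, 3)) -
        ∑ x, f x * (B (x, 1) + B (x, 3)) := by
    rw [Fintype.sum_prod_type, ← Finset.sum_sub_distrib]
    refine Finset.sum_congr rfl fun x _ => ?_
    rw [Fintype.sum_bool]
    change (f (D.opp (x, 1)).1 - f x) * B (x, 1) + (f (D.opp (x, 3)).1 - f x) * B (x, 3) = _
    ring
  have e2 := hA.sum_upper fun d => f (D.opp d).1 * B d
  simp only [D.opp_opp, B, faceDiff_opp] at e2
  rw [e1, e2, ← Finset.sum_sub_distrib]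
  refine Finset.sum_eq_zero fun x _ => ?_
  have h1 : (1 : ZMod 4) - 1 = 0 := by decide
  have h2 : (2 : ZMod 4) - 1 = 1 := by decide
  have h3 : (3 : ZMod 4) - 1 = 2 := by decide
  have h0 : (0 : ZMod 4) - 1 = 3 := by decide
  simp only [B, faceDiff, h0, h1, h2, h3]
  ring

/-- Euler's inequality, for alternating diagrams on closed surfaces. -/
theorem Alternating.card_face_le (hA : D.Alternating) :
    Nat.card D.Face ≤ Nat.card D.Crossing + 2 * Nat.card D.Component := by
  classical
  have : Fintype D.Face := Fintype.ofFinite _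
  have : Fintype D.Component := Fintype.ofFinite _
  -- The edge space has dimension `2V` and the two coboundary images are orthogonal in it, of
  -- dimensions at least `V - C` and `F - C`.
  have hdisj : Disjoint (LinearMap.range D.crossingCoboundary) (LinearMap.range D.faceCoboundary) := by
    rw [Submodule.disjoint_def]
    rintro u ⟨f, rfl⟩ ⟨g, hg⟩
    have h0 := hA.coboundary_orthogonal f g
    rw [hg] at h0
    funext o
    have := (Finset.sum_eq_zero_iff_of_nonneg (fun o _ => mul_self_nonneg _)).1 h0 o
      (Finset.mem_univ o)
    exact mul_self_eq_zero.1 this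
  have hle := Submodule.finrank_add_finrank_le_of_disjoint hdisj
  have r1 := D.crossingCoboundary.finrank_range_add_finrank_ker
  have r2 := D.faceCoboundary.finrank_range_add_finrank_ker
  -- Each kernel consists of functions constant on connected components.
  have k1 : Module.finrank ℚ (LinearMap.ker D.crossingCoboundary) ≤ Fintype.card D.Component := by
    have hs : LinearMap.ker D.crossingCoboundary ≤
        LinearMap.range (LinearMap.funLeft ℚ ℚ D.component) := by
      intro f hf
      have hf' : ∀ o, f (D.opp (D.upperDart o)).1 - f o.1 = 0 := fun o => congrFun hf o
      obtain ⟨h, hh⟩ := exists_component_factor f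
        (hA.forall_dart (fun o => sub_eq_zero.1 (hf' o)) fun d hd => by
          rw [D.opp_opp] at hd; exact hd.symm)
      exact ⟨h, funext hh⟩
    refine (Submodule.finrank_mono hs).trans ?_
    refine (LinearMap.finrank_range_le _).trans ?_
    rw [Module.finrank_fintype_fun_eq_card]
  have k2 : Module.finrank ℚ (LinearMap.ker D.faceCoboundary) ≤ Fintype.card D.Component := by
    have hs : LinearMap.ker D.faceCoboundary ≤
        LinearMap.range (LinearMap.funLeft ℚ ℚ D.faceComponent) := by
      intro g hg
      have hg' : ∀ d, D.faceDiff g d = 0 :=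
        hA.forall_dart (fun o => congrFun hg o) fun d hd => by
          rw [faceDiff_opp] at hd; exact neg_eq_zero.1 hd
      have hrot : ∀ x i, g (D.face (x, i)) = g (D.face (x, 0)) := by
        have step : ∀ x i, g (D.face (x, i)) = g (D.face (x, i - 1)) := fun x i =>
          sub_eq_zero.1 (hg' (x, i))
        have h1 : (1 : ZMod 4) - 1 = 0 := by decide
        have h2 : (2 : ZMod 4) - 1 = 1 := by decide
        have h3 : (3 : ZMod 4) - 1 = 2 := by decide
        intro x i
        rcases zmod_four_cases i with rfl | rfl | rfl | rfl
        · rfl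
        · rw [step, h1]
        · rw [step, h2, step, h1]
        · rw [step, h3, step, h2, step, h1]
      obtain ⟨h, hh⟩ := exists_component_factor (fun x => g (D.face (x, 0))) fun d => by
        rw [← hrot d.1 d.2, ← hrot (D.opp d).1 ((D.opp d).2 - 1)]
        exact congrArg g (face_faceNext d)
      refine ⟨h, funext fun F => ?_⟩
      induction F using Quot.ind with
      | mk d => exact (hh d.1).trans (hrot d.1 d.2).symm
    refine (Submodule.finrank_mono hs).trans ?_
    refine (LinearMap.finrank_range_le _).trans ?_
    rw [Module.finrank_fintype_fun_eq_card]
  rw [Module.finrank_fintype_fun_eq_card] at hle r1 r2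
  rw [Fintype.card_prod, Fintype.card_bool] at hle
  simp only [Nat.card_eq_fintype_card]
  omega


/-! ### Two-edge cuts and the closed-up pieces -/

/-- A set of crossings of an alternating diagram which is joined with its complement by two edges.
The dart `out` belongs to an upper strand and `inn` to a lower one. -/
structure TwoEdgeCut (D : PreDiagram) where
  side : Set D.Crossing
  out : D.Dart
  inn : D.Dart
  isOver_out : IsOver out
  not_isOver_inn : ¬ IsOver inn
  crosses_iff : ∀ d : D.Dart, (d.1 ∈ side ∧ (D.opp d).1 ∉ side) ↔ d = out ∨ d = inn

theorem Alternating.exists_twoEdgeCut (hA : D.Alternating) {S : Set D.Crossing}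
    (hS : (D.outDarts S).card = 1) : ∃ C : D.TwoEdgeCut, C.side = S := by
  obtain ⟨p, hp⟩ := Finset.card_eq_one.1 hS
  obtain ⟨q, hq⟩ := Finset.card_eq_one.1 ((hA.card_inDarts S).trans hS)
  have hp' : ∀ d, d ∈ D.outDarts S ↔ d = p := fun d => by rw [hp, Finset.mem_singleton]
  have hq' : ∀ d, d ∈ D.inDarts S ↔ d = q := fun d => by rw [hq, Finset.mem_singleton]
  refine ⟨⟨S, p, q, (mem_outDarts.1 ((hp' p).2 rfl)).1, (mem_inDarts.1 ((hq' q).2 rfl)).1,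
    fun d => ?_⟩, rfl⟩
  rw [← hp', ← hq', mem_outDarts, mem_inDarts]
  tauto

namespace TwoEdgeCut

variable (C : D.TwoEdgeCut)

theorem out_mem : C.out.1 ∈ C.side := ((C.crosses_iff _).2 (.inl rfl)).1

theorem inn_mem : C.inn.1 ∈ C.side := ((C.crosses_iff _).2 (.inr rfl)).1

theorem opp_out_notMem : (D.opp C.out).1 ∉ C.side := ((C.crosses_iff _).2 (.inl rfl)).2

theorem opp_inn_notMem : (D.opp C.inn).1 ∉ C.side := ((C.crosses_iff _).2 (.inr rfl)).2

theorem out_ne_inn : C.out ≠ C.inn := fun h => C.not_isOver_inn (h ▸ C.isOver_out)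

/-- The same cut, seen from the other side. -/
def compl (hA : D.Alternating) : D.TwoEdgeCut where
  side := C.sideᶜ
  out := D.opp C.inn
  inn := D.opp C.out
  isOver_out := (hA _).2 C.not_isOver_inn
  not_isOver_inn := fun h => (hA _).1 h C.isOver_out
  crosses_iff d := by
    have h := C.crosses_iff (D.opp d)
    have h1 : D.opp d = C.out ↔ d = D.opp C.out :=
      ⟨fun h => by rw [← h, D.opp_opp], fun h => by rw [h, D.opp_opp]⟩
    have h2 : D.opp d = C.inn ↔ d = D.opp C.inn :=
      ⟨fun h => by rw [← h, D.opp_opp], fun h => by rw [h, D.opp_opp]⟩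
    rw [D.opp_opp, h1, h2] at h
    rw [Set.mem_compl_iff, Set.mem_compl_iff, not_not, and_comm, h, or_comm]

open Classical in
/-- The involution which joins the two ends of the cut edges on one side. -/
noncomputable def sideOpp (d : D.Dart) : D.Dart :=
  if d = C.out then C.inn else if d = C.inn then C.out else D.opp d

theorem sideOpp_out : C.sideOpp C.out = C.inn := if_pos rfl

theorem sideOpp_inn : C.sideOpp C.inn = C.out := by
  rw [sideOpp, if_neg C.out_ne_inn.symm, if_pos rfl]

theorem sideOpp_of_ne {d : D.Dart} (h1 : d ≠ C.out) (h2 : d ≠ C.inn) :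
    C.sideOpp d = D.opp d := by
  rw [sideOpp, if_neg h1, if_neg h2]

theorem sideOpp_mem {d : D.Dart} (h : d.1 ∈ C.side) : (C.sideOpp d).1 ∈ C.side := by
  by_cases h1 : d = C.out
  · rw [h1, sideOpp_out]; exact C.inn_mem
  by_cases h2 : d = C.inn
  · rw [h2, sideOpp_inn]; exact C.out_mem
  rw [C.sideOpp_of_ne h1 h2]
  by_contra h3
  exact ((C.crosses_iff d).1 ⟨h, h3⟩).elim h1 h2

theorem sideOpp_sideOpp {d : D.Dart} (h : d.1 ∈ C.side) : C.sideOpp (C.sideOpp d) = d := by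
  by_cases h1 : d = C.out
  · rw [h1, sideOpp_out, sideOpp_inn]
  by_cases h2 : d = C.inn
  · rw [h2, sideOpp_inn, sideOpp_out]
  rw [C.sideOpp_of_ne h1 h2, C.sideOpp_of_ne, D.opp_opp]
  · intro h3
    apply C.opp_out_notMem
    rwa [← h3, D.opp_opp]
  · intro h3
    apply C.opp_inn_notMem
    rwa [← h3, D.opp_opp]

theorem sideOpp_ne (d : D.Dart) : C.sideOpp d ≠ d := by
  by_cases h1 : d = C.out
  · rw [h1, sideOpp_out]; exact C.out_ne_inn.symm
  by_cases h2 : d = C.inn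
  · rw [h2, sideOpp_inn]; exact C.out_ne_inn
  rw [C.sideOpp_of_ne h1 h2]
  exact D.opp_ne d

/-- The part of the diagram on one side of the cut, closed up by joining the two ends. -/
noncomputable def piece : PreDiagram where
  Crossing := C.side
  finite := have := D.finite; inferInstance
  opp d := (⟨(C.sideOpp (d.1.1, d.2)).1, C.sideOpp_mem d.1.2⟩, (C.sideOpp (d.1.1, d.2)).2)
  opp_opp d := by
    have h := C.sideOpp_sideOpp (d := (d.1.1, d.2)) d.1.2
    have h1 := congrArg Prod.fst h
    have h2 := congrArg Prod.snd h
    exact Prod.ext (Subtype.ext h1) h2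
  opp_ne d h := by
    have h1 := congrArg (fun e => e.1.1) h
    have h2 := congrArg Prod.snd h
    exact C.sideOpp_ne (d.1.1, d.2) (Prod.ext h1 h2)
  circles := 0

/-- The darts of a piece are darts of the diagram. -/
def emb (d : C.piece.Dart) : D.Dart := (d.1.1, d.2)

/-- The dart of a piece given by a dart of the diagram. -/
def toPiece (d : D.Dart) (h : d.1 ∈ C.side) : C.piece.Dart := (⟨d.1, h⟩, d.2)

theorem emb_injective : Function.Injective C.emb := by
  intro d e h
  have h1 := congrArg Prod.fst h
  have h2 := congrArg Prod.snd h
  exact Prod.ext (Subtype.ext h1) h2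

theorem emb_opp (d : C.piece.Dart) : C.emb (C.piece.opp d) = C.sideOpp (C.emb d) := rfl

theorem piece_alternating (hA : D.Alternating) : C.piece.Alternating := by
  intro d
  change IsOver (D := D) (C.sideOpp (C.emb d)) ↔ ¬ IsOver (C.emb d)
  by_cases h1 : C.emb d = C.out
  · rw [h1, sideOpp_out]
    exact iff_of_false C.not_isOver_inn (not_not.2 C.isOver_out)
  by_cases h2 : C.emb d = C.inn
  · rw [h2, sideOpp_inn]
    exact iff_of_true C.isOver_out C.not_isOver_inn
  rw [C.sideOpp_of_ne h1 h2]
  exact hA _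

theorem emb_faceNext_of_ne {d : C.piece.Dart} (h1 : C.emb d ≠ C.out) (h2 : C.emb d ≠ C.inn) :
    C.emb (C.piece.faceNext d) = D.faceNext (C.emb d) := by
  change ((C.sideOpp (C.emb d)).1, (C.sideOpp (C.emb d)).2 - 1) = _
  rw [C.sideOpp_of_ne h1 h2]; rfl

theorem emb_faceNext_out {d : C.piece.Dart} (h : C.emb d = C.out) :
    C.emb (C.piece.faceNext d) = D.faceNext (D.opp C.inn) := by
  change ((C.sideOpp (C.emb d)).1, (C.sideOpp (C.emb d)).2 - 1) = _
  rw [h, sideOpp_out, faceNext, D.opp_opp]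

theorem emb_faceNext_inn {d : C.piece.Dart} (h : C.emb d = C.inn) :
    C.emb (C.piece.faceNext d) = D.faceNext (D.opp C.out) := by
  change ((C.sideOpp (C.emb d)).1, (C.sideOpp (C.emb d)).2 - 1) = _
  rw [h, sideOpp_inn, faceNext, D.opp_opp]

end TwoEdgeCut

/-! ### Faces of the pieces, connectedness and planarity -/

theorem faceNext_injective (D : PreDiagram) : Function.Injective D.faceNext := by
  intro d e h
  obtain ⟨h1, h2⟩ := Prod.mk.inj h
  rw [← D.opp_opp d, ← D.opp_opp e]
  exact congrArg D.opp (Prod.ext h1 (sub_left_injective h2))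

/-- In an alternating diagram, the corners of each face have the same parity. -/
theorem Alternating.isOver_faceNext (hA : D.Alternating) (d : D.Dart) :
    IsOver (D := D) (D.faceNext d) ↔ IsOver d := by
  have h : IsOver (D := D) (D.faceNext d) ↔ ¬ IsOver (D := D) (D.opp d) := by
    rw [not_isOver_iff]
    exact (by decide : ∀ i : ZMod 4, (i - 1 = 1 ∨ i - 1 = 3) ↔ (i = 0 ∨ i = 2)) _
  rw [h, hA, not_not]

theorem Alternating.isOver_iff_of_face_eq (hA : D.Alternating) {d e : D.Dart}
    (h : D.face d = D.face e) : IsOver d ↔ IsOver e :=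
  iff_of_eq (congrArg (Quot.lift (fun d : D.Dart => IsOver d) (by
    rintro a b rfl
    exact propext (hA.isOver_faceNext a).symm)) h)

namespace TwoEdgeCut

variable (C : D.TwoEdgeCut)

/-- By injectivity and finiteness the face walk in the piece returns to `e`. After its first step
from `e` it follows a face walk of `D` until then, as it meets no other end of a cut edge. -/
theorem face_eq_of_orbit {e : C.piece.Dart} {t : D.Dart}
    (h0 : C.emb (C.piece.faceNext e) = D.faceNext t)
    (h : ∀ k, C.piece.faceNext^[k] e = e ∨ (C.emb (C.piece.faceNext^[k] e) ≠ C.out ∧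
      C.emb (C.piece.faceNext^[k] e) ≠ C.inn)) : D.face (C.emb e) = D.face t := by
  have key : ∀ k, D.face (C.emb (C.piece.faceNext^[k + 1] e)) = D.face t := by
    intro k
    induction k with
    | zero => rw [zero_add, Function.iterate_one, h0, face_faceNext]
    | succ k ih =>
      rw [Function.iterate_succ_apply']
      rcases h (k + 1) with h1 | ⟨h1, h2⟩
      · rw [h1, h0, face_faceNext]
      · rw [C.emb_faceNext_of_ne h1 h2, face_faceNext, ih]
  obtain ⟨n, hn, hper⟩ := C.piece.faceNext_injective.mem_periodicPts e
  have := key (n - 1)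
  rwa [Nat.sub_add_cancel hn, hper] at this

theorem iterate_isOver (hA : D.Alternating) (e : C.piece.Dart) (k : ℕ) :
    IsOver (C.emb (C.piece.faceNext^[k] e)) ↔ IsOver (C.emb e) := by
  induction k with
  | zero => rfl
  | succ k ih =>
    rw [Function.iterate_succ_apply', ← ih]
    exact (C.piece_alternating hA).isOver_faceNext _

/-- The two cut edges share this face. Corners of one face have equal parity, so the face walk of
the piece from the upper dart `out` never meets the lower dart `inn`; no Jordan curve argument is
needed. -/
theorem face_out (hA : D.Alternating) : D.face C.out = D.face (D.opp C.inn) := by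
  refine C.face_eq_of_orbit (e := C.toPiece C.out C.out_mem)
    (C.emb_faceNext_out rfl) fun k => ?_
  have hk := (C.iterate_isOver hA (C.toPiece C.out C.out_mem) k).2 C.isOver_out
  by_cases h1 : C.emb (C.piece.faceNext^[k] (C.toPiece C.out C.out_mem)) = C.out
  · exact .inl (C.emb_injective h1)
  · exact .inr ⟨h1, fun h2 => C.not_isOver_inn (h2 ▸ hk)⟩

theorem face_inn (hA : D.Alternating) : D.face C.inn = D.face (D.opp C.out) := by
  refine C.face_eq_of_orbit (e := C.toPiece C.inn C.inn_mem)
    (C.emb_faceNext_inn rfl) fun k => ?_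
  have hk := (C.iterate_isOver hA (C.toPiece C.inn C.inn_mem) k).not.2 C.not_isOver_inn
  by_cases h1 : C.emb (C.piece.faceNext^[k] (C.toPiece C.inn C.inn_mem)) = C.inn
  · exact .inl (C.emb_injective h1)
  · exact .inr ⟨fun h2 => hk (h2 ▸ C.isOver_out), h1⟩

/-- The face of the diagram which contains a given face of a piece. -/
def faceMap (hA : D.Alternating) : C.piece.Face → D.Face :=
  Quot.lift (fun d => D.face (C.emb d)) (by
    rintro d _ rfl
    by_cases h1 : C.emb d = C.out
    · rw [C.emb_faceNext_out h1, h1, face_faceNext, C.face_out hA]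
    by_cases h2 : C.emb d = C.inn
    · rw [C.emb_faceNext_inn h2, h2, face_faceNext, C.face_inn hA]
    rw [C.emb_faceNext_of_ne h1 h2, face_faceNext])

/-- Faces of the piece map to faces of `D`, so a nugatory crossing of the piece is nugatory in `D`.
-/
theorem piece_reduced (hA : D.Alternating) (hR : D.Reduced) : C.piece.Reduced := by
  rintro x (h | h)
  · exact hR x.1 (.inl (congrArg (C.faceMap hA) h))
  · exact hR x.1 (.inr (congrArg (C.faceMap hA) h))

/-- The faces of both pieces cover those of `D`, and the two faces along the closing edge of one
piece have the same images as those of the other. They are distinct, by parity, so two faces are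
redundant. -/
theorem card_face_add_two_le (hA : D.Alternating) :
    Nat.card D.Face + 2 ≤ Nat.card C.piece.Face + Nat.card (C.compl hA).piece.Face := by
  classical
  have : Fintype D.Face := Fintype.ofFinite _
  have : Fintype C.piece.Face := Fintype.ofFinite _
  have : Fintype (C.compl hA).piece.Face := Fintype.ofFinite _
  let C' := C.compl hA
  let Ψ : C.piece.Face ⊕ C'.piece.Face → D.Face := Sum.elim (C.faceMap hA) (C'.faceMap hA)
  let a : C.piece.Face := C.piece.face (C.toPiece C.out C.out_mem)
  let b : C.piece.Face := C.piece.face (C.toPiece C.inn C.inn_mem)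
  let a' : C'.piece.Face := C'.piece.face (C'.toPiece C'.out C'.out_mem)
  let b' : C'.piece.Face := C'.piece.face (C'.toPiece C'.inn C'.inn_mem)
  have hab : a ≠ b := fun h => C.not_isOver_inn
    (((C.piece_alternating hA).isOver_iff_of_face_eq h).1 C.isOver_out)
  have haa' : Ψ (Sum.inl a) = Ψ (Sum.inr a') := C.face_out hA
  have hbb' : Ψ (Sum.inl b) = Ψ (Sum.inr b') := C.face_inn hA
  let T : Finset (C.piece.Face ⊕ C'.piece.Face) := {Sum.inl a, Sum.inl b}
  have hT : T.card = 2 := Finset.card_pair fun h => hab (Sum.inl_injective h)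
  have hsurj : Set.SurjOn Ψ (Tᶜ : Finset _) (Finset.univ : Finset D.Face) := by
    intro F _
    induction F using Quot.ind with
    | mk d =>
      have hr : ∀ f : C'.piece.Face, Sum.inr f ∈ (Tᶜ : Finset _) := fun f => by
        simp [T]
      by_cases hd : d.1 ∈ C.side
      · have hΨ : Ψ (Sum.inl (C.piece.face (C.toPiece d hd))) = D.face d := rfl
        by_cases h1 : C.piece.face (C.toPiece d hd) = a
        · exact ⟨_, hr a', by rw [← haa', ← h1]; exact hΨ⟩
        by_cases h2 : C.piece.face (C.toPiece d hd) = b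
        · exact ⟨_, hr b', by rw [← hbb', ← h2]; exact hΨ⟩
        refine ⟨Sum.inl (C.piece.face (C.toPiece d hd)), ?_, hΨ⟩
        simp [T, h1, h2]
      · exact ⟨_, hr (C'.piece.face (C'.toPiece d hd)), rfl⟩
  have hcard := Finset.card_le_card_of_surjOn Ψ hsurj
  rw [Finset.card_compl, hT, Finset.card_univ, Fintype.card_sum] at hcard
  have h2 : 2 ≤ Fintype.card C.piece.Face := by
    rw [← Finset.card_pair hab]
    exact Finset.card_le_univ _
  simp only [Nat.card_eq_fintype_card]
  change _ ≤ _ + Fintype.card C'.piece.Face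
  omega

theorem piece_connected [Subsingleton D.Component] : Subsingleton C.piece.Component := by
  let pc : ∀ v : D.Crossing, v ∈ C.side → C.piece.Component := fun v h =>
    C.piece.component (⟨v, h⟩ : C.side)
  have hcongr : ∀ {v w} (h : v ∈ C.side) (h' : w ∈ C.side), v = w → pc v h = pc w h' := by
    rintro v _ h h' rfl
    rfl
  have hsub : ∀ (d : D.Dart) (h : d.1 ∈ C.side),
      pc (C.sideOpp d).1 (C.sideOpp_mem h) = pc d.1 h := fun d h =>
    (Quot.sound ⟨d.2, rfl⟩ : pc d.1 h = pc (C.sideOpp d).1 (C.sideOpp_mem h)).symm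
  have hinn : pc C.inn.1 C.inn_mem = pc C.out.1 C.out_mem := by
    rw [← hsub C.out C.out_mem]
    exact hcongr _ _ (congrArg Prod.fst C.sideOpp_out).symm
  -- Crossings outside the side belong to `T` vacuously; a path re-entering the side does so at
  -- `out` or `inn`, which the closing edge joins.
  let T : Set D.Crossing := {v | ∀ h : v ∈ C.side, pc v h = pc C.out.1 C.out_mem}
  have hT : T = Set.univ := by
    refine eq_univ_of_closed ⟨C.out.1, fun _ => rfl⟩ fun d hd h => ?_
    by_cases h1 : d.1 ∈ C.side
    · have hne : ∀ e, (e = C.out ∨ e = C.inn) → d ≠ e := fun e he hde =>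
        ((C.crosses_iff e).2 he).2 (hde ▸ h)
      rw [← hd h1, ← hsub d h1]
      exact hcongr _ _ (congrArg Prod.fst
        (C.sideOpp_of_ne (hne _ (.inl rfl)) (hne _ (.inr rfl)))).symm
    · have h2 := (C.crosses_iff (D.opp d)).1 ⟨h, by rwa [D.opp_opp]⟩
      rcases h2 with h2 | h2
      · exact hcongr _ _ (congrArg Prod.fst h2)
      · rw [← hinn]
        exact hcongr _ _ (congrArg Prod.fst h2)
  have key : ∀ F : C.piece.Component, F = pc C.out.1 C.out_mem := by
    intro F
    induction F using Quot.ind with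
    | mk x => exact (hT ▸ Set.mem_univ x.1 : x.1 ∈ T) x.2
  exact ⟨fun F G => (key F).trans (key G).symm⟩

theorem piece_nonempty : Nonempty C.piece.Crossing := ⟨(⟨C.out.1, C.out_mem⟩ : C.side)⟩

theorem card_piece_component [Subsingleton D.Component] : Nat.card C.piece.Component = 1 := by
  have := C.piece_connected
  obtain ⟨x⟩ := C.piece_nonempty
  have : Nonempty C.piece.Component := ⟨C.piece.component x⟩
  exact Nat.card_eq_one_iff_unique.2 ⟨inferInstance, inferInstance⟩

/-- The pieces have `V` crossings in all and at least `F + 2 = V + 4` faces, while Euler's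
inequality allows each at most two more faces than crossings; so equality holds in both. -/
theorem piece_planar [Subsingleton D.Component] (hA : D.Alternating) (hP : D.Planar) :
    C.piece.Planar ∧ (C.compl hA).piece.Planar := by
  have h1 := C.card_face_add_two_le hA
  have h2 := (C.piece_alternating hA).card_face_le
  have h3 := ((C.compl hA).piece_alternating hA).card_face_le
  have h4 : Nat.card D.Component = 1 :=
    Nat.card_eq_one_iff_unique.2 ⟨inferInstance, ⟨D.component C.out.1⟩⟩
  have h5 : Nat.card C.piece.Crossing + Nat.card (C.compl hA).piece.Crossing =
      Nat.card D.Crossing := by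
    have := D.finite
    change Nat.card C.side + Nat.card ↥(C.sideᶜ) = _
    rw [Nat.card_coe_set_eq, Nat.card_coe_set_eq, Set.ncard_add_ncard_compl]
  rw [card_piece_component] at h2 h3
  rw [Planar, h4] at hP
  rw [Planar, Planar, card_piece_component, card_piece_component]
  omega

/-! ### Connected sum decomposition -/

/-- The crossings of a diagram are those of the two pieces. -/
noncomputable def crossingEquiv (hA : D.Alternating) :
    (C.piece.union (C.compl hA).piece).Crossing ≃ D.Crossing :=
  letI := Classical.decPred (· ∈ C.side)
  (Equiv.Set.sumCompl C.side : C.side ⊕ ↥(C.sideᶜ) ≃ D.Crossing)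

/-- A diagram with a two-edge cut is a connected sum of the two pieces. -/
theorem connectedSum_iso (hA : D.Alternating) (hc : D.circles = 0) :
    (C.piece.connectedSum (C.compl hA).piece (C.toPiece C.out C.out_mem)
      ((C.compl hA).toPiece (C.compl hA).inn (C.compl hA).inn_mem)).Iso D := by
  classical
  let C' := C.compl hA
  let U := C.piece.union C'.piece
  let a := C.toPiece C.out C.out_mem
  let b := C'.toPiece C'.inn C'.inn_mem
  obtain ⟨o1, o2, o3, o4, o5⟩ := U.reconnectOpp_of_ne (p := inl C'.piece a) (q := inr C.piece b)
    (inl_ne_inr _ _).symm (by rw [union_opp_inl]; exact (inl_ne_inr _ _).symm)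
  let φ : U.Dart → D.Dart := fun d => (C.crossingEquiv hA d.1, d.2)
  have hl : ∀ d, φ (inl C'.piece d) = C.emb d := fun _ => rfl
  have hr : ∀ d, φ (inr C.piece d) = C'.emb d := fun _ => rfl
  have ha : C.emb a = C.out := rfl
  have hb : C'.emb b = D.opp C.out := rfl
  have ha' : C.emb (C.piece.opp a) = C.inn := by rw [emb_opp, ha, sideOpp_out]
  have hb' : C'.emb (C'.piece.opp b) = D.opp C.inn := by
    rw [emb_opp]; exact C'.sideOpp_inn
  have key : ∀ d : U.Dart, D.opp (φ d) = φ (U.reconnectOpp (inl C'.piece a) (inr C.piece b) d) := by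
    intro d
    by_cases h1 : d = inl C'.piece a
    · rw [h1, o1, hl, hr, ha, hb]
    by_cases h2 : d = inr C.piece b
    · rw [h2, o2, hl, hr, ha, hb, D.opp_opp]
    by_cases h3 : d = U.opp (inl C'.piece a)
    · rw [h3, o3, union_opp_inl, union_opp_inr, hl, hr, ha', hb']
    by_cases h4 : d = U.opp (inr C.piece b)
    · rw [h4, o4, union_opp_inl, union_opp_inr, hl, hr, ha', hb', D.opp_opp]
    rw [o5 d h1 h2 h3 h4]
    rcases union_dart_cases d with ⟨d, rfl⟩ | ⟨d, rfl⟩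
    · rw [union_opp_inl, hl, hl, emb_opp, sideOpp_of_ne]
      · exact fun h => h1 (congrArg _ (C.emb_injective (h.trans ha.symm)))
      · refine fun h => h3 ?_
        rw [union_opp_inl]
        exact congrArg _ (C.emb_injective (h.trans ha'.symm))
    · rw [union_opp_inr, hr, hr, emb_opp, sideOpp_of_ne]
      · refine fun h => h4 ?_
        rw [union_opp_inr]
        exact congrArg _ (C'.emb_injective (h.trans hb'.symm))
      · exact fun h => h2 (congrArg _ (C'.emb_injective (h.trans hb.symm)))
  refine ⟨hc.symm, C.crossingEquiv hA, fun _ => 0, fun _ => .inl rfl, fun d => ?_⟩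
  have := key d
  simp only [φ] at this
  rw [add_zero, add_zero]
  exact this

/-- A reduced connected alternating diagram with a two-edge cut does not represent a prime link. -/
theorem not_representsPrimeLink {D : LinkDiagram} (C : D.TwoEdgeCut) (hA : D.Alternating)
    (hR : D.Reduced) (hc : D.circles = 0) [Subsingleton D.Component] :
    ¬ D.RepresentsPrimeLink := by
  rintro ⟨-, -, h⟩
  obtain ⟨p1, p2⟩ := C.piece_planar hA D.planar
  have aux : ∀ (C : D.TwoEdgeCut) (hP : C.piece.Planar),
      ¬ LinkDiagram.IsUnknot ⟨C.piece, hP⟩ := by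
    intro C hP hu
    have := C.piece_connected
    have := C.piece_nonempty
    exact hu.not_hasNonconstantColoring
      ((C.piece_reduced hA hR).hasNonconstantColoring_col (C.piece_alternating hA) rfl)
  rcases h ⟨C.piece, p1⟩ ⟨(C.compl hA).piece, p2⟩ ⟨D, _, _, Relation.EqvGen.refl _,
    Relation.EqvGen.refl _, Relation.EqvGen.refl _, _, _, C.connectedSum_iso hA hc⟩ with hu | hu
  · exact aux _ _ hu
  · exact aux _ _ hu

end TwoEdgeCut

/-! ### The reduced group of colorings -/

/-- The homomorphism `Col(D) → ℤ` which sends each arc to `1`. -/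
def colDegree (D : PreDiagram) : D.Col →+ ℤ :=
  QuotientAddGroup.lift D.colRelations (FreeAbelianGroup.lift fun _ => 1) (by
    rw [colRelations, AddSubgroup.closure_le]
    rintro _ ⟨x, rfl⟩
    simp [AddMonoidHom.mem_ker])

theorem colDegree_colArc (a : D.Arc) : D.colDegree (D.colArc a) = 1 :=
  FreeAbelianGroup.lift_apply_of _ _

/-- The class of an arc in the reduced group of colorings. -/
def colRedArc (D : PreDiagram) (base a : D.Arc) : D.ColRed base := QuotientAddGroup.mk (D.colArc a)

theorem colRedArc_base (base : D.Arc) : D.colRedArc base base = 0 :=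
  (QuotientAddGroup.eq_zero_iff _).2 (AddSubgroup.mem_zmultiples _)

/-- The difference of two arcs has degree `0`, whereas `m` times the base arc has degree `m`. -/
theorem colArc_eq_of_colRedArc_eq {base a b : D.Arc}
    (h : D.colRedArc base a = D.colRedArc base b) : D.colArc a = D.colArc b := by
  obtain ⟨m, hm⟩ := AddSubgroup.mem_zmultiples_iff.1 ((QuotientAddGroup.eq_iff_sub_mem).1 h)
  have := congrArg D.colDegree hm
  rw [map_zsmul, map_sub, colDegree_colArc, colDegree_colArc, colDegree_colArc] at this
  have hm0 : m = 0 := by simpa using this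
  rw [hm0, zero_zsmul] at hm
  exact sub_eq_zero.1 hm.symm

theorem colRedArc_fox (base : D.Arc) (x : D.Crossing) :
    2 • D.colRedArc base (D.arc (x, 1)) - D.colRedArc base (D.arc (x, 0)) -
      D.colRedArc base (D.arc (x, 2)) = 0 := by
  have h := D.isDartColoring_colArc.fox x
  rw [arc_three, ← two_nsmul] at h
  have h' := congrArg (QuotientAddGroup.mk' (AddSubgroup.zmultiples (D.colArc base))) h
  rw [map_add, map_nsmul] at h'
  rw [sub_sub, sub_eq_zero]
  exact h'.symm

/-- A homomorphism to `ℤ` of the reduced group of colorings of a connected alternating diagram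
vanishes. -/
theorem Alternating.colRed_hom_eq_zero (hA : D.Alternating) (hc : D.circles = 0)
    [Subsingleton D.Component] (base : D.Arc) (φ : D.ColRed base →+ ℤ) : φ = 0 := by
  -- A homomorphism to `ℤ` is an integral coloring vanishing on the base arc; the maximum principle
  -- makes it constant.
  have hconst : ∀ x y : D.Crossing, φ (D.colRedArc base (D.arc (x, 1))) =
      φ (D.colRedArc base (D.arc (y, 1))) := by
    refine hA.eq_of_fox (fun c => φ (D.colRedArc base (D.arc (c, 1)))) fun c => ?_
    have hlow : ∀ d : D.Dart, ¬ IsOver d → D.arc ((D.opp d).1, 1) = D.arc d := fun d hd => by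
      rw [← upperCrossing_of_not_isOver hd, hA.arc_upperCrossing]
    have := congrArg φ (colRedArc_fox base c)
    rw [map_sub, map_sub, map_nsmul, map_zero, nsmul_eq_mul] at this
    rw [hlow _ (not_isOver_zero c), hlow _ (not_isOver_two c)]
    exact_mod_cast this
  have harc : ∀ a : D.Arc, φ (D.colRedArc base a) = 0 := fun a => by
    rw [← hA.arc_arcCrossing hc a, hconst _ (hA.arcCrossing hc base), hA.arc_arcCrossing,
      colRedArc_base, map_zero]
  ext a
  exact harc a

/-- As the link is not split, `D` itself is connected; the alternative of a lone crossingless circle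
is the unknot. -/
theorem _root_.LinkDiagram.RepresentsPrimeLink.connected {D : LinkDiagram}
    (h : D.RepresentsPrimeLink) :
    D.circles = 0 ∧ Subsingleton D.Component := by
  have hconn : D.Connected := by
    by_contra hn
    exact h.2.1 ⟨D, Relation.EqvGen.refl _, hn⟩
  rw [Connected] at hconn
  have hc : D.circles = 0 := by
    by_contra hc
    have h0 : Nat.card D.Component = 0 := by omega
    have hempty : IsEmpty D.Crossing := by
      refine ⟨fun x => ?_⟩
      have : Nonempty D.Component := ⟨D.component x⟩
      exact Nat.card_pos.ne' h0
    refine h.1 (Relation.EqvGen.rel _ _ (.inl ⟨?_, ?_⟩))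
    · change D.circles = 1
      omega
    · have : IsEmpty LinkDiagram.unknot.Crossing := inferInstanceAs (IsEmpty Empty)
      exact ⟨Equiv.equivOfIsEmpty _ _, fun _ => 0, fun _ => .inl rfl, fun d => hempty.elim d.1⟩
  refine ⟨hc, ?_⟩
  rw [hc, add_zero] at hconn
  exact (Nat.card_eq_one_iff_unique.1 hconn).1

/-- Distinct arcs of a reduced alternating diagram of a prime link are distinct in `Col(D)`. -/
theorem colArc_injective {D : LinkDiagram} (hR : D.Reduced) (hA : D.Alternating)
    (hprime : D.RepresentsPrimeLink) : Function.Injective D.colArc := by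
  obtain ⟨hc, hconn⟩ := hprime.connected
  intro a b hab
  by_contra hne
  rw [← hA.arc_arcCrossing hc a, ← hA.arc_arcCrossing hc b] at hab
  obtain ⟨S, -, -, hS⟩ := hA.exists_cut_of_colArc_eq hc
    (fun h => hne (by rw [← hA.arc_arcCrossing hc a, h, hA.arc_arcCrossing])) hab
  obtain ⟨C, -⟩ := hA.exists_twoEdgeCut hS
  exact C.not_representsPrimeLink hA hR hc hprime

end PreDiagram

/-! ### From the universal group to finite colorings -/

theorem exists_zmod_embedding {k n : ℕ} (hkn : k ∣ n) (hn : n ≠ 0) :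
    ∃ ι : ZMod k →+ ZMod n, Function.Injective ι := by
  obtain ⟨q, rfl⟩ := hkn
  have hq : (q : ℤ) ≠ 0 := by
    rintro h
    exact hn (by rw [Int.natCast_eq_zero.1 h, mul_zero])
  -- The embedding is multiplication by `q = n / k`.
  let f : ℤ →+ ZMod (k * q) := (Int.castAddHom _).comp (AddMonoidHom.mulRight (q : ℤ))
  have hf : ∀ z, f z = ((z * q : ℤ) : ZMod (k * q)) := fun _ => rfl
  refine ⟨ZMod.lift k ⟨f, ?_⟩, ?_⟩
  · rw [hf]
    exact_mod_cast ZMod.natCast_self (k * q)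
  · rw [ZMod.lift_injective]
    intro z hz
    rw [hf, ZMod.intCast_zmod_eq_zero_iff_dvd] at hz
    rw [ZMod.intCast_zmod_eq_zero_iff_dvd]
    push_cast at hz
    exact Int.dvd_of_mul_dvd_mul_right hq hz

theorem theorem3p5 (D : LinkDiagram) (hreduced : D.Reduced) (halternating : D.Alternating)
    (hprime : D.RepresentsPrimeLink) (base : D.Arc)
    (s : ℕ) (hs : 0 < s) (n : Fin s → ℕ)
    (hdvd : ∀ (i : ℕ) (hi : i + 1 < s), n ⟨i + 1, hi⟩ ∣ n ⟨i, Nat.lt_of_succ_lt hi⟩)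
    (hcol : Nonempty (D.ColRed base ≃+ ((i : Fin s) → ZMod (n i)))) :
    ∃ c : Fin s → D.Arc → ZMod (n ⟨0, hs⟩),
      (∀ i, D.IsFoxColoring (n ⟨0, hs⟩) (c i)) ∧
      ∀ x y : D.Arc, x ≠ y → ∃ i, c i x ≠ c i y := by
  obtain ⟨hc, hconn⟩ := hprime.connected
  obtain ⟨e⟩ := hcol
  let π : ∀ i, D.ColRed base →+ ZMod (n i) := fun i =>
    (Pi.evalAddMonoidHom (fun i => ZMod (n i)) i).comp e.toAddMonoidHom
  have hπ : ∀ i z, π i z = e z i := fun _ _ => rfl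
  have hn : n ⟨0, hs⟩ ≠ 0 := by
    intro h0
    -- If `n₁ = 0`, the first factor is `ℤ`, and its projection is a nonzero homomorphism from the
    -- reduced group to `ℤ`.
    obtain ⟨ψ, hψ⟩ : ∃ ψ : ZMod (n ⟨0, hs⟩) →+ ℤ, ψ 1 = 1 := by
      rw [h0]
      exact ⟨AddMonoidHom.id ℤ, rfl⟩
    have h1 := halternating.colRed_hom_eq_zero hc base (ψ.comp (π ⟨0, hs⟩))
    have h2 := DFunLike.congr_fun h1 (e.symm fun _ => 1)
    rw [AddMonoidHom.comp_apply, hπ, e.apply_symm_apply, hψ] at h2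
    exact one_ne_zero h2
  have hdvd0 : ∀ (i : ℕ) (hi : i < s), n ⟨i, hi⟩ ∣ n ⟨0, hs⟩ := by
    intro i
    induction i with
    | zero => exact fun _ => dvd_rfl
    | succ i ih => exact fun hi => (hdvd i hi).trans (ih _)
  choose ι hι using fun i : Fin s => exists_zmod_embedding (hdvd0 i.1 i.2) hn
  refine ⟨fun i a => ι i (π i (D.colRedArc base a)), fun i x => ?_, fun x y hxy => ?_⟩
  · have := congrArg (fun z => ι i (π i z)) (PreDiagram.colRedArc_fox base x)
    simp only [map_sub, map_nsmul, map_zero] at this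
    rw [two_nsmul, ← two_mul] at this
    exact this
  · by_contra! h
    -- Arcs on which all the colorings agree have equal coordinates, hence equal classes in the
    -- reduced group and then in `Col(D)`.
    refine hxy (PreDiagram.colArc_injective hreduced halternating hprime
      (PreDiagram.colArc_eq_of_colRedArc_eq (base := base) (e.injective (funext fun i => ?_))))
    exact hι i (h i)
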